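/- Let $k$ be a field, $a\ge 3$ an integer, $q\in k$ a primitive $a$-th root of unity, and let $A=k\langle X,Y\rangle/(X^a,\,XY-qYX,\,Y^a)$, with $x,y$ the residue classes of $X,Y$. Let $A^e=A\otimes_k A^{\mathrm{op}}$ and let $HH^*(A)=\bigoplus_{n\ge0}\mathrm{Ext}^n_{A^e}(A,A)$ be the Hochschild cohomology algebra, with the Yoneda product. For $s\in\{0,1\}$ put $$\tau_x(s)=q^s(1\otimes x)-x\otimes 1,\qquad \tau_y(s)=1\otimes y-q^s(y\otimes 1),$$ $$\gamma_x(s)=\sum_{j=0}^{a-1}q^{js}(x^{a-1-j}\otimes x^j),\qquad \gamma_y(s)=\sum_{j=0}^{a-1}q^{js}(y^j\otimes y^{a-1-j}).$$ Let $P_n$ be the free left $A^e$-module with basis $f^n_0,\dots,f^n_n$ (and $f^n_{-1}=f^n_{n+1}=0$), with differentials $d_n:P_n\to P_{n-1}$ given by $$d_{2t}(f^{2t}_i)=\begin{cases}\gamma_y(0)f^{2t-1}_i+\gamma_x(0)f^{2t-1}_{i-1}& i \text{ even}\\ -\tau_y(1)f^{2t-1}_i+\tau_x(1)f^{2t-1}_{i-1}&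 i\text{ odd,}\end{cases}$$ $$d_{2t+1}(f^{2t+1}_i)=\begin{cases}\tau_y(0)f^{2t}_i+\gamma_x(1)f^{2t}_{i-1}& i \text{ even}\\ -\gamma_y(1)f^{2t}_i+\tau_x(0)f^{2t}_{i-1}& i\text{ odd.}\end{cases}$$ With the augmentation $\mu:P_0\to A$, $f^0_0\mapsto 1$, the complex $P$ is a projective resolution of $A$ over $A^e$. For $t\ge0$ and $0\le i\le 2t$ the map $P_{2t}\to A$ with $f^{2t}_i\mapsto 1$ and $f^{2t}_j\mapsto 0$ for $j\ne i$ is a cocycle; let $\zeta_i^{2t}\in HH^{2t}(A)$ be its class. Let $$R_0=\mathrm{span}_k\{\zeta_i^{2t}: t\ge 0,\ 0\le i\le 2t,\ i\text{ even}\},$$ the even part of $R=\mathrm{span}_k\{\zeta_i^{2t}: t\ge0,\ 0\le i\le 2t\}\subseteq HH^{2*}(A)$. Then $R_0$ is a subalgebra of $HH^*(A)$, and it is isomorphic, as a $k$-algebra, to the polynomial ring in two variables over $k$. -/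

import Mathlib

universe u v w

namespace HochschildQCI

noncomputable section

open CategoryTheory CategoryTheory.Abelian DirectSum

section ExtAlgebra

variable {C : Type u} [Category.{v} C] [Abelian C] [HasExt.{w} C]

/-- The family of groups `Ext^n(X, X)`, for `n : ℕ`. -/
def SelfExt (X : C) (n : ℕ) : Type w := Ext X X n

instance (X : C) (n : ℕ) : AddCommGroup (SelfExt X n) := inferInstanceAs (AddCommGroup (Ext X X n))

instance (k : Type*) [CommRing k] [Linear k C] (X : C) (n : ℕ) : Module k (SelfExt X n) :=
  inferInstanceAs (Module k (Ext X X n))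

theorem SelfExt.comp_cast {X : C} {a b c c' : ℕ} (α : Ext X X a) (β : Ext X X b) (h : a + b = c)
    (h' : a + b = c') :
    GradedMonoid.mk (A := SelfExt X) c (α.comp β h) = GradedMonoid.mk c' (α.comp β h') := by
  subst h; subst h'; rfl

theorem SelfExt.smul_id_comp {k : Type*} [CommRing k] [Linear k C] {X : C} {n : ℕ} (r : k)
    (α : Ext X X n) : (r • Ext.mk₀ (𝟙 X)).comp α (zero_add n) = r • α := by
  rw [Ext.smul_comp, Ext.mk₀_id_comp]

theorem SelfExt.comp_smul_id {k : Type*} [CommRing k] [Linear k C] {X : C} {n : ℕ} (r : k)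
    (α : Ext X X n) : α.comp (r • Ext.mk₀ (𝟙 X)) (add_zero n) = r • α := by
  rw [Ext.comp_smul, Ext.comp_mk₀_id]

instance (X : C) : GradedMonoid.GOne (SelfExt X) := ⟨Ext.mk₀ (𝟙 X)⟩

instance (X : C) : GradedMonoid.GMul (SelfExt X) := ⟨fun α β => Ext.comp α β rfl⟩

/-- `⨁ n, Ext^n(X, X)` is a graded ring under the Yoneda product. -/
instance (X : C) : DirectSum.GRing (SelfExt X) where
  mul_zero {i j} α := Ext.comp_zero (X := X) (Y := X) (n := i) α X j _ rfl
  zero_mul {i j} β := Ext.zero_comp (X := X) (Y := X) (Z := X) (n := i) (m := j) β _ rfl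
  mul_add α β γ := Ext.comp_add α β γ rfl
  add_mul α β γ := Ext.add_comp α β γ rfl
  one_mul := fun ⟨n, α⟩ => by
    refine (SelfExt.comp_cast (Ext.mk₀ (𝟙 X)) α rfl (zero_add n)).trans ?_
    exact congrArg (GradedMonoid.mk (A := SelfExt X) n) (Ext.mk₀_id_comp α)
  mul_one := fun ⟨n, α⟩ => by
    refine (SelfExt.comp_cast α (Ext.mk₀ (𝟙 X)) rfl (add_zero n)).trans ?_
    exact congrArg (GradedMonoid.mk (A := SelfExt X) n) (Ext.comp_mk₀_id α)
  mul_assoc := fun ⟨l, α⟩ ⟨m, β⟩ ⟨n, γ⟩ => by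
    refine Eq.trans ?_ (SelfExt.comp_cast α (Ext.comp β γ rfl) (add_assoc l m n).symm rfl)
    exact congrArg (GradedMonoid.mk (A := SelfExt X) (l + m + n))
      (Ext.comp_assoc α β γ rfl rfl rfl)
  natCast n := n • Ext.mk₀ (𝟙 X)
  natCast_zero := zero_nsmul _
  natCast_succ n := succ_nsmul _ n
  intCast n := n • Ext.mk₀ (𝟙 X)
  intCast_ofNat n := natCast_zsmul _ n
  intCast_negSucc_ofNat n := negSucc_zsmul _ n

instance (k : Type*) [CommRing k] [Linear k C] (X : C) : DirectSum.GAlgebra k (SelfExt X) where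
  toFun :=
    { toFun r := r • Ext.mk₀ (𝟙 X)
      map_zero' := zero_smul k (Ext.mk₀ (𝟙 X))
      map_add' r s := add_smul r s (Ext.mk₀ (𝟙 X)) }
  map_one := one_smul k (Ext.mk₀ (𝟙 X))
  map_mul r s := by
    refine congrArg (GradedMonoid.mk (A := SelfExt X) 0) ?_
    change (r * s) • Ext.mk₀ (𝟙 X) =
      (r • Ext.mk₀ (𝟙 X)).comp (s • Ext.mk₀ (𝟙 X)) (add_zero 0)
    rw [Ext.smul_comp, Ext.comp_smul, Ext.comp_mk₀_id, mul_smul]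
  commutes r := fun ⟨n, α⟩ => by
    refine (SelfExt.comp_cast (r • Ext.mk₀ (𝟙 X)) α rfl (zero_add n)).trans ?_
    refine Eq.trans ?_ (SelfExt.comp_cast α (r • Ext.mk₀ (𝟙 X)) rfl (add_zero n)).symm
    exact congrArg (GradedMonoid.mk (A := SelfExt X) n)
      ((SelfExt.smul_id_comp r α).trans (SelfExt.comp_smul_id r α).symm)
  smul_def r := fun ⟨n, α⟩ => by
    refine Eq.trans ?_ (SelfExt.comp_cast (r • Ext.mk₀ (𝟙 X)) α rfl (zero_add n)).symm
    exact congrArg (GradedMonoid.mk (A := SelfExt X) n) (SelfExt.smul_id_comp r α).symm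

end ExtAlgebra

open scoped TensorProduct

/-- The enveloping algebra `A ⊗ Aᵒᵖ`. -/
def Env (k : Type u) (A : Type u) [Field k] [Ring A] [Algebra k A] : Type u := A ⊗[k] Aᵐᵒᵖ

section Env

variable (k : Type u) (A : Type u) [Field k] [Ring A] [Algebra k A]

instance : Ring (Env k A) := inferInstanceAs (Ring (A ⊗[k] Aᵐᵒᵖ))

instance : Algebra k (Env k A) := inferInstanceAs (Algebra k (A ⊗[k] Aᵐᵒᵖ))

/-- `A` is a left module over its enveloping algebra, by `(u ⊗ v) • w = u w v`. -/
instance : Module (Env k A) A := instModuleTensorProductMop k A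

end Env

/-- The algebra `A`, viewed as a left module over its enveloping algebra. -/
abbrev regular (k : Type u) (A : Type u) [Field k] [Ring A] [Algebra k A] :
    ModuleCat.{u} (Env k A) := ModuleCat.of (Env k A) A

/-- Modules over the enveloping algebra of a `k`-algebra form a `k`-linear category. -/
instance (k : Type u) (A : Type u) [Field k] [Ring A] [Algebra k A] :
    Linear k (ModuleCat.{u} (Env k A)) := ModuleCat.Algebra.instLinear

/-- The Hochschild cohomology algebra `HH^*(A) = Ext^*(A, A)` over the enveloping algebra of `A`,
with the Yoneda product. -/
abbrev HH (k : Type u) (A : Type u) [Field k] [Ring A] [Algebra k A] : Type u :=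
  ⨁ n, SelfExt (regular k A) n

/-! ### The quantum complete intersection -/

/-- The defining relations `X^a = 0`, `X Y = q Y X`, `Y^a = 0` on the free algebra on `X` (index `0`)
and `Y` (index `1`). -/
inductive QCIRel (k : Type u) [Field k] (a : ℕ) (q : k) :
    FreeAlgebra k (Fin 2) → FreeAlgebra k (Fin 2) → Prop
  | x_pow : QCIRel k a q (FreeAlgebra.ι k 0 ^ a) 0
  | comm : QCIRel k a q (FreeAlgebra.ι k 0 * FreeAlgebra.ι k 1)
      (q • (FreeAlgebra.ι k 1 * FreeAlgebra.ι k 0))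
  | y_pow : QCIRel k a q (FreeAlgebra.ι k 1 ^ a) 0

/-- The algebra `A = k⟨X, Y⟩ / (X^a, XY - qYX, Y^a)`. -/
def QCI (k : Type u) [Field k] (a : ℕ) (q : k) : Type u := RingQuot (QCIRel k a q)

section Resolution

variable {k : Type u} [Field k] {a : ℕ} {q : k}

instance : Ring (QCI k a q) := inferInstanceAs (Ring (RingQuot (QCIRel k a q)))

instance : Algebra k (QCI k a q) := inferInstanceAs (Algebra k (RingQuot (QCIRel k a q)))

variable (k a q) in
/-- The residue class of `X`. -/
def x : QCI k a q := RingQuot.mkAlgHom k (QCIRel k a q) (FreeAlgebra.ι k 0)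

variable (k a q) in
/-- The residue class of `Y`. -/
def y : QCI k a q := RingQuot.mkAlgHom k (QCIRel k a q) (FreeAlgebra.ι k 1)

theorem x_pow : x k a q ^ a = 0 := by
  have h := RingQuot.mkAlgHom_rel k (QCIRel.x_pow (k := k) (a := a) (q := q))
  rw [map_pow, map_zero] at h
  exact h

theorem y_pow : y k a q ^ a = 0 := by
  have h := RingQuot.mkAlgHom_rel k (QCIRel.y_pow (k := k) (a := a) (q := q))
  rw [map_pow, map_zero] at h
  exact h

theorem x_mul_y : x k a q * y k a q = q • (y k a q * x k a q) := by
  have h := RingQuot.mkAlgHom_rel k (QCIRel.comm (k := k) (a := a) (q := q))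
  rw [map_smul, map_mul, map_mul] at h
  exact h

theorem x_pow_mul_y_pow (m l : ℕ) :
    x k a q ^ m * y k a q ^ l = q ^ (m * l) • (y k a q ^ l * x k a q ^ m) := by
  have h1 : ∀ l : ℕ, x k a q * y k a q ^ l = q ^ l • (y k a q ^ l * x k a q) := by
    intro l
    induction l with
    | zero => simp
    | succ l ih =>
      rw [pow_succ, ← mul_assoc, ih, smul_mul_assoc, mul_assoc, x_mul_y, mul_smul_comm, smul_smul,
        ← pow_succ, mul_assoc]
  induction m with
  | zero => simp
  | succ m ih =>
    rw [pow_succ, mul_assoc, h1, mul_smul_comm, ← mul_assoc, ih, smul_mul_assoc, smul_smul,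
      mul_assoc, ← pow_add]
    congr 2
    ring

/-- The pure tensor `u ⊗ v` of the enveloping algebra. -/
def tens (u v : QCI k a q) : Env k (QCI k a q) := u ⊗ₜ[k] MulOpposite.op v

theorem tens_mul_tens (u v u' v' : QCI k a q) :
    tens u v * tens u' v' = tens (u * u') (v' * v) :=
  Algebra.TensorProduct.tmul_mul_tmul u u' (MulOpposite.op v) (MulOpposite.op v')

theorem tens_zero (u : QCI k a q) : tens u 0 = 0 := TensorProduct.tmul_zero _ u

theorem zero_tens (v : QCI k a q) : tens 0 v = 0 := TensorProduct.zero_tmul _ (MulOpposite.op v)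

theorem tens_smul (u v w : QCI k a q) : tens u v • w = u * w * v := by
  change u • MulOpposite.op v • w = _
  simp [mul_assoc]

variable (k a q) in
/-- `τ_x(s) = q^s (1 ⊗ x) - x ⊗ 1`. -/
def tauX (s : ℕ) : Env k (QCI k a q) := q ^ s • tens 1 (x k a q) - tens (x k a q) 1

variable (k a q) in
/-- `τ_y(s) = 1 ⊗ y - q^s (y ⊗ 1)`. -/
def tauY (s : ℕ) : Env k (QCI k a q) := tens 1 (y k a q) - q ^ s • tens (y k a q) 1

variable (k a q) in
/-- `γ_x(s) = ∑_{j=0}^{a-1} q^{js} (x^{a-1-j} ⊗ x^j)`. -/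
def gammaX (s : ℕ) : Env k (QCI k a q) :=
  ∑ j ∈ Finset.range a, q ^ (j * s) • tens (x k a q ^ (a - 1 - j)) (x k a q ^ j)

variable (k a q) in
/-- `γ_y(s) = ∑_{j=0}^{a-1} q^{js} (y^j ⊗ y^{a-1-j})`. -/
def gammaY (s : ℕ) : Env k (QCI k a q) :=
  ∑ j ∈ Finset.range a, q ^ (j * s) • tens (y k a q ^ j) (y k a q ^ (a - 1 - j))

theorem tauX_mul_gammaX (s : ℕ) : tauX k a q s * gammaX k a q s = 0 := by
  have h := Finset.sum_range_sub
    (fun j => q ^ (j * s) • tens (x k a q ^ (a - j)) (x k a q ^ j)) a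
  simp only [Nat.sub_self, x_pow, Nat.sub_zero] at h
  rw [tens_zero, zero_tens, smul_zero, smul_zero, sub_zero] at h
  rw [← h, tauX, gammaX, Finset.mul_sum]
  refine Finset.sum_congr rfl fun j hj => ?_
  have hj' := Finset.mem_range.1 hj
  rw [sub_mul, smul_mul_smul_comm, mul_smul_comm, tens_mul_tens, tens_mul_tens, one_mul, mul_one,
    ← pow_succ, ← pow_succ', ← pow_add, show a - 1 - j + 1 = a - j by omega,
    show a - (j + 1) = a - 1 - j by omega, show s + j * s = (j + 1) * s by ring]

theorem gammaX_mul_tauX (s : ℕ) : gammaX k a q s * tauX k a q s = 0 := by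
  rw [← tauX_mul_gammaX s, tauX, gammaX, Finset.mul_sum, Finset.sum_mul]
  refine Finset.sum_congr rfl fun j _ => ?_
  rw [sub_mul, mul_sub, smul_mul_smul_comm, smul_mul_smul_comm, mul_smul_comm, smul_mul_assoc]
  simp only [tens_mul_tens, one_mul, mul_one, ← pow_succ, ← pow_succ', mul_comm]

theorem tauY_mul_gammaY (s : ℕ) : tauY k a q s * gammaY k a q s = 0 := by
  have h := Finset.sum_range_sub'
    (fun j => q ^ (j * s) • tens (y k a q ^ j) (y k a q ^ (a - j))) a
  simp only [Nat.sub_self, y_pow, Nat.sub_zero] at h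
  rw [tens_zero, zero_tens, smul_zero, smul_zero, sub_zero] at h
  rw [← h, tauY, gammaY, Finset.mul_sum]
  refine Finset.sum_congr rfl fun j hj => ?_
  have hj' := Finset.mem_range.1 hj
  rw [sub_mul, smul_mul_smul_comm, mul_smul_comm, tens_mul_tens, tens_mul_tens, one_mul, mul_one,
    ← pow_succ, ← pow_succ', ← pow_add, show a - 1 - j + 1 = a - j by omega,
    show a - (j + 1) = a - 1 - j by omega, show s + j * s = (j + 1) * s by ring]

theorem gammaY_mul_tauY (s : ℕ) : gammaY k a q s * tauY k a q s = 0 := by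
  rw [← tauY_mul_gammaY s, tauY, gammaY, Finset.mul_sum, Finset.sum_mul]
  refine Finset.sum_congr rfl fun j _ => ?_
  rw [sub_mul, mul_sub, smul_mul_smul_comm, smul_mul_smul_comm, mul_smul_comm, smul_mul_assoc]
  simp only [tens_mul_tens, one_mul, mul_one, ← pow_succ, ← pow_succ', mul_comm]

theorem tens_smul_left (c : k) (u v : QCI k a q) : tens (c • u) v = c • tens u v := rfl

theorem tens_smul_right (c : k) (u v : QCI k a q) : tens u (c • v) = c • tens u v := by
  rw [tens, MulOpposite.op_smul]
  exact TensorProduct.tmul_smul c u (MulOpposite.op v)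

theorem tauY_mul_tauX : tauY k a q 1 * tauX k a q 0 = tauX k a q 1 * tauY k a q 0 := by
  simp only [tauX, tauY, pow_zero, pow_one, one_smul, sub_mul, mul_sub, smul_mul_assoc,
    tens_mul_tens, one_mul, mul_one, x_mul_y, tens_smul_left, tens_smul_right]
  abel

theorem x_pow_mul_y (m : ℕ) : x k a q ^ m * y k a q = q ^ m • (y k a q * x k a q ^ m) := by
  simpa using x_pow_mul_y_pow (k := k) (a := a) (q := q) m 1

theorem x_mul_y_pow (l : ℕ) : x k a q * y k a q ^ l = q ^ l • (y k a q ^ l * x k a q) := by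
  simpa using x_pow_mul_y_pow (k := k) (a := a) (q := q) 1 l

theorem tauY_mul_gammaX (hq : q ^ a = 1) :
    tauY k a q 0 * gammaX k a q 0 = gammaX k a q 1 * tauY k a q 1 := by
  rw [tauY, tauY, gammaX, gammaX, Finset.mul_sum, Finset.sum_mul]
  refine Finset.sum_congr rfl fun j hj => ?_
  have hj' := Finset.mem_range.1 hj
  simp only [pow_zero, mul_zero, mul_one, pow_one, one_smul, sub_mul, mul_sub, smul_mul_assoc,
    mul_smul_comm, tens_mul_tens, one_mul, x_pow_mul_y, tens_smul_left, tens_smul_right, smul_smul]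
  congr 1
  rw [← pow_add, ← pow_succ', show j + (a - 1 - j) + 1 = a by omega, hq, one_smul]

theorem tauX_mul_gammaY (hq : q ^ a = 1) :
    tauX k a q 0 * gammaY k a q 0 = gammaY k a q 1 * tauX k a q 1 := by
  rw [tauX, tauX, gammaY, gammaY, Finset.mul_sum, Finset.sum_mul]
  refine Finset.sum_congr rfl fun j hj => ?_
  have hj' := Finset.mem_range.1 hj
  simp only [pow_zero, mul_zero, mul_one, pow_one, one_smul, sub_mul, mul_sub, smul_mul_assoc,
    mul_smul_comm, tens_mul_tens, one_mul, x_mul_y_pow, tens_smul_left, tens_smul_right, smul_smul]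
  congr 1
  rw [← pow_add, ← pow_succ', show j + (a - 1 - j) + 1 = a by omega, hq, one_smul]

theorem gammaY_mul_gammaX (hq : q ^ a = 1) :
    gammaY k a q 0 * gammaX k a q 1 = gammaX k a q 0 * gammaY k a q 1 := by
  rw [gammaY, gammaX, gammaX, gammaY, Finset.sum_mul_sum, Finset.sum_mul_sum, Finset.sum_comm]
  refine Finset.sum_congr rfl fun j hj => Finset.sum_congr rfl fun l hl => ?_
  have hj' := Finset.mem_range.1 hj
  have hl' := Finset.mem_range.1 hl
  simp only [pow_zero, mul_zero, mul_one, one_smul, mul_smul_comm, tens_mul_tens,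
    x_pow_mul_y_pow, tens_smul_left, tens_smul_right, smul_smul, ← pow_add]
  congr 1
  obtain ⟨c, rfl⟩ : ∃ c, a = j + c + 1 := ⟨a - 1 - j, by omega⟩
  obtain ⟨d, hd⟩ : ∃ d, j + c + 1 = l + d + 1 := ⟨j + c - l, by omega⟩
  have e1 : j + c + 1 - 1 - j = c := by omega
  have e2 : j + c + 1 - 1 - l = d := by omega
  rw [e1, e2]
  have h1 : (j + j * d) + j * l = (j + c + 1) * j := by rw [hd]; ring
  have h2 : (l + c * l) + j * l = (j + c + 1) * l := by ring
  have h0 : q ^ (j * l) ≠ 0 := by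
    refine pow_ne_zero _ ?_
    rintro rfl
    simp at hq
  refine mul_right_cancel₀ h0 ?_
  rw [← pow_add, ← pow_add, h1, h2, pow_mul, pow_mul, hq, one_pow, one_pow]

/-- The free module `P_n` of rank `n + 1` over the enveloping algebra. -/
abbrev P (k : Type u) [Field k] (a : ℕ) (q : k) (n : ℕ) : Type u := Fin (n + 1) → Env k (QCI k a q)

variable (k a q) in
/-- The generators `f^n_0, …, f^n_n` of `P_n`, with `f^n_i = 0` for `i < 0` and for `i > n`. -/
def gen (n : ℕ) (i : ℤ) : P k a q n := fun j => if (j : ℤ) = i then 1 else 0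

variable (k a q) in
/-- The coefficient of `f^{n-1}_i` in `d_n f^n_i`. -/
def coeffY (n : ℕ) (i : ℤ) : Env k (QCI k a q) :=
  if Even n then (if Even i then gammaY k a q 0 else -tauY k a q 1)
  else (if Even i then tauY k a q 0 else -gammaY k a q 1)

variable (k a q) in
/-- The coefficient of `f^{n-1}_{i-1}` in `d_n f^n_i`. -/
def coeffX (n : ℕ) (i : ℤ) : Env k (QCI k a q) :=
  if Even n then (if Even i then gammaX k a q 0 else tauX k a q 1)
  else (if Even i then gammaX k a q 1 else tauX k a q 0)

variable (k a q) in
/-- With `n = 2t` or `n = 2t + 1`, the pair (`coeffY`, `coeffX`) encodes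
`d_{2t} f_i = γ_y(0) f_i + γ_x(0) f_{i-1}` for `i` even,
`d_{2t} f_i = -τ_y(1) f_i + τ_x(1) f_{i-1}` for `i` odd,
`d_{2t+1} f_i = τ_y(0) f_i + γ_x(1) f_{i-1}` for `i` even,
`d_{2t+1} f_i = -γ_y(1) f_i + τ_x(0) f_{i-1}` for `i` odd.
The differential `d_{n+1} : P_{n+1} → P_n`, the linear map determined by its values on the
basis `f^{n+1}_0, …, f^{n+1}_{n+1}`. -/
def diff (n : ℕ) : P k a q (n + 1) →ₗ[Env k (QCI k a q)] P k a q n :=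
  (Pi.basisFun (Env k (QCI k a q)) (Fin (n + 2))).constr ℕ fun i =>
    coeffY k a q (n + 1) i • gen k a q n i + coeffX k a q (n + 1) i • gen k a q n (i - 1)

variable (k a q) in
/-- The map `ζ_j : P_n → A` sending `f^n_j` to `1` and the other generators to `0`. -/
def zetaMap (n : ℕ) (j : ℕ) : P k a q n →ₗ[Env k (QCI k a q)] QCI k a q :=
  (Pi.basisFun (Env k (QCI k a q)) (Fin (n + 1))).constr ℕ fun i => if (i : ℕ) = j then 1 else 0

theorem gen_eq_single (n : ℕ) (i : Fin (n + 1)) :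
    gen k a q n (i : ℤ) = Pi.basisFun (Env k (QCI k a q)) (Fin (n + 1)) i := by
  funext j
  simp [gen, Pi.single_apply, Fin.ext_iff]

theorem gen_of_neg (n : ℕ) {i : ℤ} (hi : i < 0) : gen k a q n i = 0 := by
  funext j
  exact if_neg (by omega)

theorem gen_of_lt (n : ℕ) {i : ℤ} (hi : (n : ℤ) < i) : gen k a q n i = 0 := by
  funext j
  exact if_neg (by omega)

theorem diff_gen (n : ℕ) (i : ℤ) :
    diff k a q n (gen k a q (n + 1) i) =
      coeffY k a q (n + 1) i • gen k a q n i + coeffX k a q (n + 1) i • gen k a q n (i - 1) := by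
  rcases lt_or_ge i 0 with h | h
  · rw [gen_of_neg _ h, gen_of_neg _ h, gen_of_neg _ (by omega : i - 1 < 0)]
    simp
  rcases lt_or_ge ((n + 1 : ℕ) : ℤ) i with h' | h'
  · rw [gen_of_lt _ h', gen_of_lt _ (by omega), gen_of_lt _ (by omega : (n : ℤ) < i - 1)]
    simp
  lift i to ℕ using h
  have := gen_eq_single (k := k) (a := a) (q := q) (n + 1) ⟨i, by omega⟩
  simp only at this
  rw [this, diff, Module.Basis.constr_basis]

theorem zetaMap_gen (n j : ℕ) {i : ℤ} (hj : j ≤ n) :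
    zetaMap k a q n j (gen k a q n i) = if i = j then 1 else 0 := by
  rcases lt_or_ge i 0 with h | h
  · rw [gen_of_neg _ h, map_zero, if_neg (by omega)]
  rcases lt_or_ge (n : ℤ) i with h' | h'
  · rw [gen_of_lt _ h', map_zero, if_neg (by omega)]
  lift i to ℕ using h
  have := gen_eq_single (k := k) (a := a) (q := q) n ⟨i, by omega⟩
  simp only at this
  rw [this, zetaMap, Module.Basis.constr_basis]
  simp

theorem coeffY_mul_coeffY (n : ℕ) (i : ℤ) :
    coeffY k a q (n + 1) i * coeffY k a q n i = 0 := by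
  rcases Nat.even_or_odd n with hn | hn <;> rcases Int.even_or_odd i with hi | hi
  · simp [coeffY, hn, hi, Nat.even_add_one, tauY_mul_gammaY]
  · simp [coeffY, hn, Int.not_even_iff_odd.2 hi, Nat.even_add_one, gammaY_mul_tauY]
  · simp [coeffY, Nat.not_even_iff_odd.2 hn, hi, Nat.even_add_one, gammaY_mul_tauY]
  · simp [coeffY, Nat.not_even_iff_odd.2 hn, Int.not_even_iff_odd.2 hi, Nat.even_add_one,
      tauY_mul_gammaY]

theorem coeffX_mul_coeffX (n : ℕ) (i : ℤ) :
    coeffX k a q (n + 1) i * coeffX k a q n (i - 1) = 0 := by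
  rcases Nat.even_or_odd n with hn | hn <;> rcases Int.even_or_odd i with hi | hi
  · have hi' : ¬ Even (i - 1) := by simpa [Int.even_sub_one] using hi
    simp [coeffX, hn, hi, hi', Nat.even_add_one, gammaX_mul_tauX, -Int.not_even_iff_odd]
  · have hi' : Even (i - 1) := by simpa [Int.even_sub_one] using hi
    simp [coeffX, hn, Int.not_even_iff_odd.2 hi, hi', Nat.even_add_one, tauX_mul_gammaX]
  · have hi' : ¬ Even (i - 1) := by simpa [Int.even_sub_one] using hi
    simp [coeffX, Nat.not_even_iff_odd.2 hn, hi, hi', Nat.even_add_one, gammaX_mul_tauX]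
  · have hi' : Even (i - 1) := by simpa [Int.even_sub_one] using hi
    simp [coeffX, Nat.not_even_iff_odd.2 hn, Int.not_even_iff_odd.2 hi, hi', Nat.even_add_one,
      tauX_mul_gammaX]

theorem coeffY_mul_coeffX_add (hq : q ^ a = 1) (n : ℕ) (i : ℤ) :
    coeffY k a q (n + 1) i * coeffX k a q n i +
      coeffX k a q (n + 1) i * coeffY k a q n (i - 1) = 0 := by
  rcases Nat.even_or_odd n with hn | hn <;> rcases Int.even_or_odd i with hi | hi
  · have hi' : ¬ Even (i - 1) := by simpa [Int.even_sub_one] using hi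
    simp [coeffX, coeffY, hn, hi, hi', Nat.even_add_one, tauY_mul_gammaX hq]
  · have hi' : Even (i - 1) := by simpa [Int.even_sub_one] using hi
    simp [coeffX, coeffY, hn, Int.not_even_iff_odd.2 hi, hi', Nat.even_add_one,
      tauX_mul_gammaY hq]
  · have hi' : ¬ Even (i - 1) := by simpa [Int.even_sub_one] using hi
    simp [coeffX, coeffY, Nat.not_even_iff_odd.2 hn, hi, hi', Nat.even_add_one,
      gammaY_mul_gammaX hq]
  · have hi' : Even (i - 1) := by simpa [Int.even_sub_one] using hi
    simp [coeffX, coeffY, Nat.not_even_iff_odd.2 hn, Int.not_even_iff_odd.2 hi, hi',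
      Nat.even_add_one, tauY_mul_tauX]

theorem diff_comp_diff (hq : q ^ a = 1) (n : ℕ) : diff k a q n ∘ₗ diff k a q (n + 1) = 0 := by
  refine (Pi.basisFun (Env k (QCI k a q)) (Fin (n + 3))).ext fun i => ?_
  rw [← gen_eq_single, LinearMap.comp_apply, diff_gen, map_add, map_smul, map_smul, diff_gen,
    diff_gen, LinearMap.zero_apply, smul_add, smul_add, smul_smul, smul_smul, smul_smul, smul_smul,
    coeffY_mul_coeffY, coeffX_mul_coeffX]
  have h := congrArg (fun e => e • gen k a q n ((i : ℤ) - 1))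
    (coeffY_mul_coeffX_add hq (n + 1) (i : ℤ))
  simp only [add_smul] at h
  refine Eq.trans ?_ (h.trans (zero_smul (Env k (QCI k a q)) (gen k a q n ((i : ℤ) - 1))))
  have h0 (v : P k a q n) : (0 : Env k (QCI k a q)) • v = 0 := zero_smul (Env k (QCI k a q)) v
  rw [h0, h0, zero_add, add_zero]

theorem env_smul_smul (c : k) (e : Env k (QCI k a q)) (w : QCI k a q) :
    (c • e) • w = c • (e • w) := by
  have h : c • e = tens (c • 1) 1 * e := by
    rw [tens_smul_left, smul_mul_assoc]
    exact congrArg (c • ·) (one_mul e).symm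
  rw [h, mul_smul, tens_smul, mul_one, smul_mul_assoc, one_mul]

theorem zetaMap_comp_diff (hq : ∑ j ∈ Finset.range a, q ^ j = 0) (n j : ℕ) (hn : Even n)
    (hj : j ≤ n) : zetaMap k a q n j ∘ₗ diff k a q n = 0 := by
  have htx : tauX k a q 0 • (1 : QCI k a q) = 0 := by
    simp [tauX, sub_smul, tens_smul]
  have hty : tauY k a q 0 • (1 : QCI k a q) = 0 := by
    simp [tauY, sub_smul, tens_smul]
  have hgx : gammaX k a q 1 • (1 : QCI k a q) = 0 := by
    rw [gammaX, Finset.sum_smul, ← zero_smul k (x k a q ^ (a - 1)), ← hq, Finset.sum_smul]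
    refine Finset.sum_congr rfl fun j hj => ?_
    have hj' := Finset.mem_range.1 hj
    rw [env_smul_smul, tens_smul, mul_one, mul_one, ← pow_add, show a - 1 - j + j = a - 1 by omega]
  have hgy : gammaY k a q 1 • (1 : QCI k a q) = 0 := by
    rw [gammaY, Finset.sum_smul, ← zero_smul k (y k a q ^ (a - 1)), ← hq, Finset.sum_smul]
    refine Finset.sum_congr rfl fun j hj => ?_
    have hj' := Finset.mem_range.1 hj
    rw [env_smul_smul, tens_smul, mul_one, mul_one, ← pow_add, show j + (a - 1 - j) = a - 1 by omega]
  refine (Pi.basisFun (Env k (QCI k a q)) (Fin (n + 2))).ext fun i => ?_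
  rw [← gen_eq_single, LinearMap.comp_apply, diff_gen, map_add, map_smul, map_smul,
    zetaMap_gen n j hj, zetaMap_gen n j hj, LinearMap.zero_apply]
  have hn' : ¬ Even (n + 1) := by simpa [Nat.even_add_one] using hn
  have hY : coeffY k a q (n + 1) i • (1 : QCI k a q) = 0 := by
    rw [coeffY, if_neg hn']
    split_ifs
    · exact hty
    · rw [neg_smul, hgy, neg_zero]
  have hX : coeffX k a q (n + 1) i • (1 : QCI k a q) = 0 := by
    rw [coeffX, if_neg hn']
    split_ifs
    · exact hgx
    · exact htx
  split_ifs <;> simp [hX, hY]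

/-- The complex `⋯ → P_2 → P_1 → P_0` of free modules over the enveloping algebra. -/
def complexP (hq : q ^ a = 1) : ChainComplex (ModuleCat.{u} (Env k (QCI k a q))) ℕ :=
  ChainComplex.of (fun n => ModuleCat.of _ (P k a q n)) (fun n => ModuleCat.ofHom (diff k a q n))
    fun n => by rw [← ModuleCat.ofHom_comp, diff_comp_diff hq n]; rfl

theorem geom_sum_eq_zero (ha : 3 ≤ a) (hq : IsPrimitiveRoot q a) :
    ∑ j ∈ Finset.range a, q ^ j = 0 := hq.geom_sum_eq_zero (by omega)

/-- The cochain `ζ_j : P_n → A`, as a morphism of modules over the enveloping algebra. -/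
def zetaHom (hq : q ^ a = 1) (n j : ℕ) : (complexP (k := k) hq).X n ⟶ regular k (QCI k a q) :=
  ModuleCat.ofHom (zetaMap k a q n j)

theorem d_comp_zetaHom (ha : 3 ≤ a) (hq : IsPrimitiveRoot q a) (n j : ℕ) (hn : Even n)
    (hj : j ≤ n) : (complexP hq.pow_eq_one).d (n + 1) n ≫ zetaHom hq.pow_eq_one n j = 0 := by
  refine (congrArg (· ≫ zetaHom hq.pow_eq_one n j)
    (ChainComplex.of_d (fun n => ModuleCat.of _ (P k a q n))
      (fun n => ModuleCat.ofHom (diff k a q n)) n)).trans ?_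
  exact congrArg ModuleCat.ofHom (zetaMap_comp_diff (geom_sum_eq_zero ha hq) n j hn hj)

/-- The augmentation of `P` by the multiplication map `μ : P_0 = A ⊗ Aᵒᵖ → A`, `f^0_0 ↦ 1`. -/
def augmentation (ha : 3 ≤ a) (hq : IsPrimitiveRoot q a) :
    complexP hq.pow_eq_one ⟶ (ChainComplex.single₀ _).obj (regular k (QCI k a q)) :=
  ((complexP hq.pow_eq_one).toSingle₀Equiv _).symm
    ⟨zetaHom hq.pow_eq_one 0 0, d_comp_zetaHom ha hq 0 0 Even.zero le_rfl⟩

/-- Once the augmentation is known to be a quasi-isomorphism, the complex `P` is a projective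
resolution of `A` over the enveloping algebra. -/
def resolution (ha : 3 ≤ a) (hq : IsPrimitiveRoot q a) (h : QuasiIso (augmentation ha hq)) :
    ProjectiveResolution (regular k (QCI k a q)) where
  complex := complexP hq.pow_eq_one
  projective n := 
    (ModuleCat.of (Env k (QCI k a q)) (P k a q n)).projective_of_categoryTheory_projective
  π := augmentation ha hq
  quasiIso := h

/-- The class `ζ_j^{2t} ∈ HH^{2t}(A)` of the cocycle `ζ_j : P_{2t} → A`, for `0 ≤ j ≤ 2t`. -/
def zeta (ha : 3 ≤ a) (hq : IsPrimitiveRoot q a) (h : QuasiIso (augmentation ha hq))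
    (t j : ℕ) (hj : j ≤ 2 * t) : HH k (QCI k a q) :=
  DirectSum.of (SelfExt (regular k (QCI k a q))) (2 * t)
    ((resolution ha hq h).extMk (zetaHom hq.pow_eq_one (2 * t) j) (2 * t + 1) rfl
      (d_comp_zetaHom ha hq (2 * t) j (even_two_mul t) hj))

/-- The subspace `R_0 = span {ζ_j^{2t} : t ≥ 0, 0 ≤ j ≤ 2t, j even}` of `HH^*(A)`: the even part of
`R = span {ζ_j^{2t} : t ≥ 0, 0 ≤ j ≤ 2t} ⊆ HH^{2*}(A)`. -/
def R₀ (ha : 3 ≤ a) (hq : IsPrimitiveRoot q a) (h : QuasiIso (augmentation ha hq)) :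
    Submodule k (HH k (QCI k a q)) :=
  Submodule.span k {c | ∃ (t j : ℕ) (hj : j ≤ 2 * t), Even j ∧ c = zeta ha hq h t j hj}

end Resolution

end

end HochschildQCI

/-! Two facts are needed: `P` resolves `A`, and products in `Ext` can be read off from `P`.

Resolution. For fixed `i`, the coefficients keeping the index `i` alternate between `τ_y(s)` and
`γ_y(s)`, with `s` the parity of `i`. Put `W = 1 ⊗ y`, `U = q^s (y ⊗ 1)`. The enveloping algebra is
`⨁_{m<a} E W^m` with `E = A ⊗ k[x]`, `W^a = U^a = 0`, `τ_y(s) = W - U`, and `γ_y(s)` is the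
geometric sum of `W` and `U`. So right multiplications by `τ_y(s)` and `γ_y(s)` are exact against
each other, and each column is exact except in its lowest degree `n = i`. There the cokernel of
`τ_y(s)` is represented by `E`, and the maps lowering the index alternate between `γ_x(0)` and
`τ_x(0)`. These are exact by the same argument with `x` and `y` exchanged, and the kernel of `μ` is
generated by `τ_x(0)` and `τ_y(0)`. The direct sum decompositions come from the monomial basis `y^m
x^l` of `A`.

Products. The differential depends only on the parities of `n` and `i`. Hence for `n` and `i` even
the shift `f_j ↦ f_{j-i}` is a chain map `P_{n+m} → P_m`, and it lifts `ζ_i^n`; thus `ζ_i^n ζ_j^m =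
ζ_{i+j}^{n+m}` (`zetaExt_comp_zetaExt`), resting on the general formula `extMk_comp_extMk`. So `X_0
↦ ζ_0^2`, `X_1 ↦ ζ_2^2` sends `X_0^α X_1^β` to `ζ_{2β}^{2(α+β)}`, and the image is `R_0`.

Injectivity. All `τ` and `γ` act on `A` with values in the augmentation ideal `(x, y)`, so a
coboundary vanishes after `A → k`, whereas `ζ_j` takes the value `1` on `f_j`. Distinct `ζ_j` are
therefore independent in positive degree, and multiplication by `X_0` moves the constant term there.
-/

/-! ### Composition of cocycles in Hom complexes -/

namespace CochainComplex.HomComplex.Cocycle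

open CategoryTheory

variable {C : Type*} [Category* C] [Preadditive C] {K L M : CochainComplex C ℤ}

/-- The composition of morphisms to shifted complexes corresponds to the composition of cocycles. -/
theorem shiftedHom_comp_equivHomShift_symm {n m p : ℤ} (z : Cocycle K L n) (w : Cocycle L M m)
    (t : Cocycle K M p) (h : n + m = p) (ht : (t : Cochain K M p) = Cochain.comp z.1 w.1 h) :
    ShiftedHom.comp (equivHomShift.symm z) (equivHomShift.symm w) ((add_comm m n).trans h) =
      equivHomShift.symm t := by
  ext i
  have h1 := Cochain.comp_v z.1 w.1 h i (i + n) (i + n + m) rfl rfl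
  rw [← ht] at h1
  -- The iterated shift lands in degree `i + n + m` and the single shift in `i + p`; apart from this
  -- identification of degrees, the shift isomorphisms are termwise identities.
  have h2 := Cochain.v_comp_XIsoOfEq_hom t.1 i (i + n + m) (i + p) (by lia) (by lia)
  simp [ShiftedHom.comp, equivHomShift_symm_apply, Cochain.rightShift_v _ _ _ _ _ _ _ _ rfl,
    shiftFunctorAdd'_inv_app_f', HomologicalComplex.XIsoOfEq_rfl]
  rw [← h2, h1, Category.assoc]
  erw [Category.comp_id, Category.comp_id, Category.comp_id]

end CochainComplex.HomComplex.Cocycle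

/-! ### Yoneda products computed by lifting cocycles to chain maps -/

namespace CategoryTheory.ProjectiveResolution

open CategoryTheory.Abelian CochainComplex CochainComplex.HomComplex Limits

theorem comp_comp_comp_eq {C : Type*} [Category* C] {U V V' W T S : C} (a : U ⟶ V)
    (b : V ⟶ W) (c : W ⟶ T) (d : T ⟶ S)
    (e : V' ≅ W) : (a ≫ b ≫ c) ≫ d = (a ≫ b ≫ e.inv) ≫ (e.hom ≫ c) ≫ d := by
  simp

variable {C : Type*} [Category* C] [Abelian C] {X Y Z : C}
  (R : ProjectiveResolution X) (R' : ProjectiveResolution Y)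

/-- The cochain of degree `n` given by a family of maps lowering the homological degree by `n`. -/
noncomputable def loweringCochain (n : ℕ) (φ : ∀ m, R.complex.X (n + m) ⟶ R'.complex.X m) :
    Cochain R.cochainComplex R'.cochainComplex n :=
  Cochain.mk fun p q hpq ↦
    -- Homological degree `m` sits in cohomological degree `-m`; for `q > 0` the target is zero, so
    -- the value there is immaterial.
    if h : q ≤ 0 then
      (R.cochainComplexXIso p (n + q.natAbs)).hom ≫ φ q.natAbs ≫
        (R'.cochainComplexXIso q q.natAbs).inv
    else 0

theorem loweringCochain_v (n : ℕ) (φ : ∀ m, R.complex.X (n + m) ⟶ R'.complex.X m) (m : ℕ)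
    (p q : ℤ) (hpq : p + n = q) (hq : -m = q) :
    (loweringCochain R R' n φ).v p q hpq = (R.cochainComplexXIso p (n + m)).hom ≫ φ m ≫
        (R'.cochainComplexXIso q m).inv := by
  obtain rfl : m = q.natAbs := by lia
  rw [loweringCochain, Cochain.mk_v, dif_pos (by lia)]

/-- The cocycle of degree `n` given by a chain map lowering the homological degree by `n`. -/
noncomputable def loweringCocycle (n : ℕ) (φ : ∀ m, R.complex.X (n + m) ⟶ R'.complex.X m)
    (hφ : ∀ m, φ (m + 1) ≫ R'.complex.d (m + 1) m =
      (n : ℤ).negOnePow • R.complex.d (n + (m + 1)) (n + m) ≫ φ m) :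
    Cocycle R.cochainComplex R'.cochainComplex n :=
  Cocycle.mk (loweringCochain R R' n φ) _ rfl (by
    ext p q hpq
    rw [δ_v _ _ rfl _ p q hpq (q - 1) (p + 1) rfl rfl, Cochain.zero_v]
    by_cases hq : q ≤ 0
    · obtain ⟨m, rfl⟩ := Int.exists_eq_neg_ofNat hq
      rw [loweringCochain_v R R' n φ (m + 1) _ _ _ (by lia),
        loweringCochain_v R R' n φ m _ _ _ rfl,
        R.cochainComplex_d p (p + 1) (n + (m + 1)) (n + m),
        R'.cochainComplex_d _ _ (m + 1) m]
      simp [reassoc_of% (hφ m), Int.negOnePow_add, Int.negOnePow_one]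
    · exact (isZero_of_isStrictlyLE R'.cochainComplex 0 q (by lia)).eq_of_tgt _ _)

theorem cochainComplex_d_comp_eq_zero {n : ℕ} (f : R.complex.X n ⟶ Y)
    (hf : R.complex.d (n + 1) n ≫ f = 0) :
    R.cochainComplex.d (-(n + 1 : ℕ)) (-n) ≫ (R.cochainComplexXIso (-n) n rfl).hom ≫ f = 0 := by
  rw [R.cochainComplex_d _ _ (n + 1) n rfl rfl, Category.assoc, Category.assoc,
    Iso.inv_hom_id_assoc, hf, comp_zero]

variable [HasExt C]

/-- If a chain map between projective resolutions lifts a cocycle `f`, then the Yoneda product of the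
class of `f` with the class of a cocycle `g` is the class of the composition. -/
theorem extMk_comp_extMk {n m : ℕ} (f : R.complex.X n ⟶ Y)
    (hf : R.complex.d (n + 1) n ≫ f = 0) (g : R'.complex.X m ⟶ Z)
    (hg : R'.complex.d (m + 1) m ≫ g = 0)
    (φ : ∀ m, R.complex.X (n + m) ⟶ R'.complex.X m)
    (hφ : ∀ m, φ (m + 1) ≫ R'.complex.d (m + 1) m =
      (n : ℤ).negOnePow • R.complex.d (n + (m + 1)) (n + m) ≫ φ m)
    (hφf : φ 0 ≫ R'.π.f 0 = f)
    (hg' : R.complex.d (n + m + 1) (n + m) ≫ φ m ≫ g = 0) :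
    (R.extMk f (n + 1) rfl hf).comp (R'.extMk g (m + 1) rfl hg) rfl =
      R.extMk (φ m ≫ g) (n + m + 1) rfl hg' := by
  have := HasDerivedCategory.standard C
  -- The lifting property: the cocycle of `f` is the chain map `φ` followed by the augmentation of
  -- `R'`.
  have h1 : Cocycle.toSingleMk ((R.cochainComplexXIso (-n) n rfl).hom ≫ f)
      (by simp : -(n : ℤ) + n = 0) (-(n + 1 : ℕ)) (by lia)
      (R.cochainComplex_d_comp_eq_zero f hf) = (loweringCocycle R R' n φ hφ).postcomp R'.π' := by
    ext : 1
    refine (Cochain.toSingleEquiv (by simp : -(n : ℤ) + n = 0)).injective ?_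
    refine congrArg (· ≫ (HomologicalComplex.singleObjXSelf (.up ℤ) 0 Y).hom) ?_
    rw [Cocycle.toSingleMk_coe, Cochain.toSingleMk_v]
    refine Eq.trans ?_ (Cochain.comp_v (loweringCochain R R' n φ) (Cochain.ofHom R'.π')
      (add_zero _) (-n) 0 0 (by lia) (by lia)).symm
    rw [Cochain.ofHom_v, π'_f_zero, loweringCochain_v R R' n φ 0 _ _ _ (by lia)]
    subst hφf
    exact (comp_comp_comp_eq _ (φ 0) _ _ (R'.cochainComplexXIso 0 0)).trans
      (congrArg _ (Category.assoc _ _ _))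
  -- At the level of complexes, `φ` followed by the cocycle of `g` is the cocycle of `φ m ≫ g`.
  have h2 := Cocycle.shiftedHom_comp_equivHomShift_symm (loweringCocycle R R' n φ hφ)
    (Cocycle.toSingleMk ((R'.cochainComplexXIso (-m) m rfl).hom ≫ g)
      (by simp : -(m : ℤ) + m = 0) (-(m + 1 : ℕ)) (by lia)
      (R'.cochainComplex_d_comp_eq_zero g hg))
    (Cocycle.toSingleMk ((R.cochainComplexXIso (-(n + m : ℕ)) (n + m) rfl).hom ≫ φ m ≫ g)
      (by simp : -((n + m : ℕ) : ℤ) + (n + m : ℕ) = 0)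
      (-(n + m + 1 : ℕ)) (by lia) (R.cochainComplex_d_comp_eq_zero _ hg'))
    (by simp) (by
      refine (Cochain.toSingleEquiv (by simp : -((n + m : ℕ) : ℤ) + (n + m : ℕ) = 0)).injective ?_
      refine congrArg (· ≫ (HomologicalComplex.singleObjXSelf (.up ℤ) 0 Z).hom) ?_
      rw [Cocycle.toSingleMk_coe, Cochain.toSingleMk_v]
      refine Eq.trans ?_ (Cochain.comp_v (loweringCochain R R' n φ) (Cochain.toSingleMk
        ((R'.cochainComplexXIso (-m) m rfl).hom ≫ g) (by simp : -(m : ℤ) + m = 0))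
        (by simp) (-(n + m : ℕ)) (-m) 0 (by lia) (by lia)).symm
      rw [Cochain.toSingleMk_v, loweringCochain_v R R' n φ m _ _ _ (by lia)]
      exact comp_comp_comp_eq _ _ _ _ _)
  ext
  rw [Ext.comp_hom, extMk_hom, extMk_hom, extMk_hom, ← h2, h1, Cocycle.equivHomShift_symm_postcomp,
    ← ShiftedHom.comp_mk₀ _ 0 rfl, ShiftedHom.map_comp, ShiftedHom.map_comp]
  -- The class of `g` begins with the inverse of the augmentation of `R'` in the derived category;
  -- it cancels the augmentation with which the class of `f` ends by `h1`.
  have h3 : DerivedCategory.Q.map R'.π' ≫ (DerivedCategory.singleFunctorIsoCompQ C 0).inv.app Y ≫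
      (DerivedCategory.singleFunctorIsoCompQ C 0).hom.app Y ≫ inv (DerivedCategory.Q.map R'.π') =
      𝟙 _ := by
    rw [Iso.inv_hom_id_app_assoc]
    exact IsIso.hom_inv_id _
  have h4 := congrArg (fun u ↦ u⟦(n : ℤ)⟧') h3
  simp only [Functor.map_comp, Functor.map_id] at h4
  rw [ShiftedHom.map_mk₀]
  simp only [ShiftedHom.mk₀_comp, ShiftedHom.comp_mk₀]
  simp only [ShiftedHom.comp, Functor.map_comp, Category.assoc, reassoc_of% h4]
  rw [← (shiftFunctorAdd' (DerivedCategory C) (m : ℤ) n (n + m : ℕ) (by lia)).inv.naturality]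
  rfl

end CategoryTheory.ProjectiveResolution

/-! ### Exactness of `W - U` against the geometric sum -/

/-- Right multiplication by the powers of `W` presents `R` as the direct sum of `a` copies of `E`. -/
structure IsTruncatedPolynomialOver {R : Type*} [Ring R] (E : AddSubgroup R) (W : R) (a : ℕ) :
    Prop where
  pow_eq_zero : W ^ a = 0
  exists_eq (z : R) : ∃ e : ℕ → R, (∀ m, e m ∈ E) ∧ z = ∑ m ∈ Finset.range a, e m * W ^ m
  eq_zero (e : ℕ → R) : (∀ m, e m ∈ E) → ∑ m ∈ Finset.range a, e m * W ^ m = 0 →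
    ∀ m < a, e m = 0

namespace IsTruncatedPolynomialOver

variable {R : Type*} [Ring R] {E : AddSubgroup R} {U W : R} {a : ℕ}

/-- The remainder theorem: `W^m - U^m` is a left multiple of `W - U`, so `W` may be replaced by `U`
modulo the left ideal of `W - U`. -/
theorem exists_eq_add_mul_sub (h : IsTruncatedPolynomialOver E W a) (hUW : Commute W U)
    (hE : ∀ e ∈ E, e * U ∈ E) (z : R) : ∃ e ∈ E, ∃ w, z = e + w * (W - U) := by
  obtain ⟨e, he, rfl⟩ := h.exists_eq z
  have hE' (m : ℕ) (r : ℕ) : e m * U ^ r ∈ E := by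
    induction r with
    | zero => simpa using he m
    | succ r ih => rw [pow_succ, ← mul_assoc]; exact hE _ ih
  refine ⟨∑ m ∈ Finset.range a, e m * U ^ m, AddSubgroup.sum_mem _ fun m _ => hE' m m,
    ∑ m ∈ Finset.range a, e m * ∑ i ∈ Finset.range m, W ^ i * U ^ (m - 1 - i), ?_⟩
  rw [Finset.sum_mul, ← Finset.sum_add_distrib]
  refine Finset.sum_congr rfl fun m _ => ?_
  rw [mul_assoc, hUW.geom_sum₂_mul, mul_sub, add_sub_cancel]

/-- The coefficient of `W^{a-1}` in the product is `e` itself. -/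
theorem eq_zero_of_mul_geom_sum_eq_zero (h : IsTruncatedPolynomialOver E W a) (ha : 0 < a)
    (hE : ∀ e ∈ E, e * U ∈ E) (hUW : Commute W U) {e : R} (he : e ∈ E)
    (h0 : e * ∑ j ∈ Finset.range a, W ^ j * U ^ (a - 1 - j) = 0) : e = 0 := by
  have hE' (r : ℕ) : e * U ^ r ∈ E := by
    induction r with
    | zero => simpa using he
    | succ r ih => rw [pow_succ, ← mul_assoc]; exact hE _ ih
  have := h.eq_zero (fun j => e * U ^ (a - 1 - j)) (fun j => hE' _) (by
    rw [← h0, Finset.mul_sum]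
    refine Finset.sum_congr rfl fun j _ => ?_
    rw [mul_assoc, (hUW.pow_pow _ _).eq]) (a - 1) (by omega)
  simpa using this

theorem sub_mul_geom_sum (h : IsTruncatedPolynomialOver E W a) (hUW : Commute W U)
    (hU : U ^ a = 0) : (W - U) * ∑ j ∈ Finset.range a, W ^ j * U ^ (a - 1 - j) = 0 := by
  rw [hUW.mul_geom_sum₂, h.pow_eq_zero, hU, sub_zero]

/-- Multiplying by the geometric sum kills `w * (W - U)` but is injective on `E`. Together with the
remainder theorem, this makes `E` a complement of the left ideal of `W - U`. -/
theorem eq_zero_of_eq_mul_sub (h : IsTruncatedPolynomialOver E W a) (ha : 0 < a)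
    (hE : ∀ e ∈ E, e * U ∈ E) (hUW : Commute W U) (hU : U ^ a = 0) {e w : R} (he : e ∈ E)
    (hw : e = w * (W - U)) : e = 0 := by
  refine h.eq_zero_of_mul_geom_sum_eq_zero ha hE hUW he ?_
  rw [hw, mul_assoc, h.sub_mul_geom_sum hUW hU, mul_zero]

theorem exists_eq_mul_sub (h : IsTruncatedPolynomialOver E W a) (ha : 0 < a)
    (hE : ∀ e ∈ E, e * U ∈ E) (hUW : Commute W U) (hU : U ^ a = 0) {z : R}
    (hz : z * ∑ j ∈ Finset.range a, W ^ j * U ^ (a - 1 - j) = 0) : ∃ w, z = w * (W - U) := by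
  obtain ⟨e, he, w, rfl⟩ := h.exists_eq_add_mul_sub hUW hE z
  rw [add_mul, mul_assoc, h.sub_mul_geom_sum hUW hU, mul_zero, add_zero] at hz
  rw [h.eq_zero_of_mul_geom_sum_eq_zero ha hE hUW he hz]
  exact ⟨w, zero_add _⟩

theorem exists_eq_mul_geom_sum (h : IsTruncatedPolynomialOver E W a)
    (hE : ∀ e ∈ E, e * U ∈ E) (hUW : Commute W U) {z : R} (hz : z * (W - U) = 0) :
    ∃ w, z = w * ∑ j ∈ Finset.range a, W ^ j * U ^ (a - 1 - j) := by
  obtain ⟨e, he, rfl⟩ := h.exists_eq z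
  rcases a.eq_zero_or_pos with rfl | ha
  · exact ⟨0, by simp⟩
  obtain ⟨b, rfl⟩ : ∃ b, a = b + 1 := ⟨a - 1, by omega⟩
  -- Compare coefficients of `W^m` in `z * (W - U) = 0`; the top term `e_{a-1} W^a` drops out. The
  -- result is `e_{m-1} = e_m U`, so all coefficients are determined by the last one.
  have h1 := h.eq_zero (fun m => (if m = 0 then 0 else e (m - 1)) - e m * U)
    (fun m => E.sub_mem (by split_ifs; exacts [E.zero_mem, he _]) (hE _ (he m))) (by
      refine Eq.trans ?_ hz
      rw [mul_sub, Finset.sum_mul, Finset.sum_mul]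
      simp only [sub_mul _ _ (W ^ _), Finset.sum_sub_distrib]
      congr 1
      · rw [Finset.sum_range_succ', Finset.sum_range_succ (fun m => e m * W ^ m * W), mul_assoc (e b),
          ← pow_succ, h.pow_eq_zero]
        simp [mul_assoc, pow_succ]
      · refine Finset.sum_congr rfl fun m _ => ?_
        rw [mul_assoc, mul_assoc, (hUW.pow_left m).eq])
  have h2 : ∀ r ≤ b, e (b - r) = e b * U ^ r := by
    intro r
    induction r with
    | zero => simp
    | succ r ih =>
      intro hr
      have := h1 (b - r) (by omega)
      rw [if_neg (by omega), ih (by omega), sub_eq_zero, mul_assoc, ← pow_succ] at this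
      rw [← this, Nat.sub_add_eq]
  refine ⟨e b, ?_⟩
  rw [Finset.mul_sum]
  refine Finset.sum_congr rfl fun m hm => ?_
  have hm' := Finset.mem_range.1 hm
  rw [(hUW.pow_pow _ _).eq, ← mul_assoc, ← h2 _ (by omega)]
  congr 2
  omega

end IsTruncatedPolynomialOver

/-! ### The monomial basis of the quantum complete intersection -/

namespace HochschildQCI

noncomputable section

variable {k : Type*} [Field k] {a : ℕ} {q : k}

variable (k a) in
/-- The standard basis of `⨁_{m, l < a} k`, extended by zero. -/
def pbwVec (m l : ℕ) : ℕ × ℕ →₀ k := if m < a ∧ l < a then Finsupp.single (m, l) 1 else 0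

variable (k a q) in
/-- The action of `x` on the monomials `y^m x^l`. -/
def pbwX : Module.End k (ℕ × ℕ →₀ k) :=
  Finsupp.linearCombination k fun p => q ^ p.1 • pbwVec k a p.1 (p.2 + 1)

variable (k a) in
/-- The action of `y` on the monomials `y^m x^l`. -/
def pbwY : Module.End k (ℕ × ℕ →₀ k) :=
  Finsupp.linearCombination k fun p => pbwVec k a (p.1 + 1) p.2

theorem pbwVec_eq_zero {m l : ℕ} (h : a ≤ m ∨ a ≤ l) : pbwVec k a m l = 0 := if_neg (by omega)

theorem pbwX_single (p : ℕ × ℕ) :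
    pbwX k a q (Finsupp.single p 1) = q ^ p.1 • pbwVec k a p.1 (p.2 + 1) := by
  rw [pbwX, Finsupp.linearCombination_single, one_smul]

theorem pbwY_single (p : ℕ × ℕ) :
    pbwY k a (Finsupp.single p 1) = pbwVec k a (p.1 + 1) p.2 := by
  rw [pbwY, Finsupp.linearCombination_single, one_smul]

theorem pbwX_pbwVec (m l : ℕ) : pbwX k a q (pbwVec k a m l) = q ^ m • pbwVec k a m (l + 1) := by
  by_cases h : m < a ∧ l < a
  · rw [pbwVec, if_pos h, pbwX, Finsupp.linearCombination_single, one_smul]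
  · rw [pbwVec, if_neg h, pbwVec, if_neg (by omega), map_zero, smul_zero]

theorem pbwY_pbwVec (m l : ℕ) : pbwY k a (pbwVec k a m l) = pbwVec k a (m + 1) l := by
  by_cases h : m < a ∧ l < a
  · rw [pbwVec, if_pos h, pbwY, Finsupp.linearCombination_single, one_smul]
  · rw [pbwVec, if_neg h, pbwVec, if_neg (by omega), map_zero]

theorem pbwX_pow_pbwVec (r m l : ℕ) :
    (pbwX k a q ^ r) (pbwVec k a m l) = q ^ (m * r) • pbwVec k a m (l + r) := by
  induction r with
  | zero => simp
  | succ r ih =>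
    rw [pow_succ', Module.End.mul_apply, ih, map_smul, pbwX_pbwVec, smul_smul, ← pow_add]
    rfl

theorem pbwY_pow_pbwVec (r m l : ℕ) :
    (pbwY k a ^ r) (pbwVec k a m l) = pbwVec k a (m + r) l := by
  induction r with
  | zero => simp
  | succ r ih => rw [pow_succ', Module.End.mul_apply, ih, pbwY_pbwVec]; rfl

variable (k a q) in
/-- The action of the quantum complete intersection on the span of the monomials `y^m x^l`. -/
def pbwRep (ha : 0 < a) : QCI k a q →ₐ[k] Module.End k (ℕ × ℕ →₀ k) :=
  RingQuot.liftAlgHom k ⟨FreeAlgebra.lift k ![pbwX k a q, pbwY k a], by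
    obtain ⟨b, rfl⟩ : ∃ b, a = b + 1 := ⟨a - 1, by omega⟩
    rintro _ _ (_ | _ | _)
    · rw [map_pow, map_zero, FreeAlgebra.lift_ι_apply]
      ext p : 1
      refine LinearMap.ext_ring ?_
      -- The space also has basis vectors outside the box `m, l < a`. Splitting off one application
      -- sends every basis vector to a multiple of a `pbwVec`, to which the remaining power applies.
      simp [pow_succ, pbwX_single, pbwX_pow_pbwVec, pbwVec_eq_zero]
    · simp only [map_mul, map_smul, FreeAlgebra.lift_ι_apply]
      ext p : 1
      refine LinearMap.ext_ring ?_
      simp [pbwX_single, pbwY_single, pbwX_pbwVec, pbwY_pbwVec, smul_smul, pow_succ']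
    · rw [map_pow, map_zero, FreeAlgebra.lift_ι_apply]
      ext p : 1
      refine LinearMap.ext_ring ?_
      simp [pow_succ, pbwY_single, pbwY_pow_pbwVec, pbwVec_eq_zero]⟩

theorem pbwRep_x (ha : 0 < a) : pbwRep k a q ha (x k a q) = pbwX k a q := by
  refine (RingQuot.liftAlgHom_mkAlgHom_apply k _ _ _).trans ?_
  simp

theorem pbwRep_y (ha : 0 < a) : pbwRep k a q ha (y k a q) = pbwY k a := by
  refine (RingQuot.liftAlgHom_mkAlgHom_apply k _ _ _).trans ?_
  simp

variable (k a q) in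
/-- The coefficient of `y^m x^l`. -/
def pbwCoord (ha : 0 < a) (m l : ℕ) : QCI k a q →ₗ[k] k :=
  Finsupp.lapply (m, l) ∘ₗ LinearMap.applyₗ (pbwVec k a 0 0) ∘ₗ (pbwRep k a q ha).toLinearMap

theorem pbwCoord_monomial (ha : 0 < a) {m l : ℕ} (hm : m < a) (hl : l < a) (m' l' : ℕ) :
    pbwCoord k a q ha m l (y k a q ^ m' * x k a q ^ l') = if m' = m ∧ l' = l then 1 else 0 := by
  simp only [pbwCoord, LinearMap.comp_apply, AlgHom.toLinearMap_apply, map_mul, map_pow, pbwRep_x,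
    pbwRep_y, LinearMap.applyₗ_apply_apply, Module.End.mul_apply, pbwX_pow_pbwVec,
    Finsupp.lapply_apply, pbwY_pow_pbwVec, zero_mul, pow_zero, one_smul, zero_add]
  rw [pbwVec]
  split_ifs with h1 h2 h2
  · rw [h2.1, h2.2, Finsupp.single_eq_same]
  · exact Finsupp.single_eq_of_ne (by rw [Ne, Prod.mk.injEq]; tauto)
  · omega
  · rfl

variable (k a q) in
/-- The projection from the free algebra. -/
def proj : FreeAlgebra k (Fin 2) →ₐ[k] QCI k a q := RingQuot.mkAlgHom k (QCIRel k a q)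

/-- The monomials `y^m x^l` span the quantum complete intersection. -/
theorem span_monomials :
    Submodule.span k (Set.range fun p : ℕ × ℕ => y k a q ^ p.1 * x k a q ^ p.2) = ⊤ := by
  set S := Submodule.span k (Set.range fun p : ℕ × ℕ => y k a q ^ p.1 * x k a q ^ p.2) with hS
  -- The span is stable under left multiplication by the generators and contains `1`, so it is
  -- everything.
  have key (b : FreeAlgebra k (Fin 2)) :
      ∀ s ∈ S, proj k a q b * s ∈ S := by
    induction b with
    | grade0 r =>
      intro s hs
      rw [AlgHom.commutes, ← Algebra.smul_def]
      exact S.smul_mem r hs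
    | grade1 i =>
      intro s hs
      induction hs using Submodule.span_induction with
      | zero => rw [mul_zero]; exact S.zero_mem
      | add u v _ _ hu hv => rw [mul_add]; exact S.add_mem hu hv
      | smul c u _ hu => rw [mul_smul_comm]; exact S.smul_mem c hu
      | mem u hu =>
        obtain ⟨⟨m, l⟩, rfl⟩ := hu
        fin_cases i
        · change x k a q * (y k a q ^ m * x k a q ^ l) ∈ S
          rw [← mul_assoc, x_mul_y_pow, smul_mul_assoc, mul_assoc, ← pow_succ']
          exact S.smul_mem _ (Submodule.subset_span ⟨(m, l + 1), rfl⟩)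
        · change y k a q * (y k a q ^ m * x k a q ^ l) ∈ S
          rw [← mul_assoc, ← pow_succ']
          exact Submodule.subset_span ⟨(m + 1, l), rfl⟩
    | mul u v hu hv =>
      intro s hs
      rw [map_mul, mul_assoc]
      exact hu _ (hv _ hs)
    | add u v hu hv =>
      intro s hs
      rw [map_add, add_mul]
      exact S.add_mem (hu _ hs) (hv _ hs)
  rw [eq_top_iff]
  rintro z -
  obtain ⟨b, rfl⟩ := RingQuot.mkAlgHom_surjective k (QCIRel k a q) z
  have := key b 1 (Submodule.subset_span ⟨(0, 0), by simp⟩)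
  rwa [mul_one] at this

end

end HochschildQCI

/-! ### The enveloping algebra as truncated polynomials; exactness for `τ` and `γ` -/

namespace HochschildQCI

open scoped TensorProduct

noncomputable section

variable {k : Type*} [Field k] {a : ℕ} {q : k}

theorem tens_add_left (u u' v : QCI k a q) : tens (u + u') v = tens u v + tens u' v :=
  TensorProduct.add_tmul u u' (MulOpposite.op v)

theorem tens_add_right (u v v' : QCI k a q) : tens u (v + v') = tens u v + tens u v' :=
  TensorProduct.tmul_add u (MulOpposite.op v) (MulOpposite.op v')

theorem one_tens_one : tens (1 : QCI k a q) 1 = 1 := rfl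

theorem tens_one_pow (u : QCI k a q) (m : ℕ) : tens u 1 ^ m = tens (u ^ m) 1 := by
  induction m with
  | zero => simp [one_tens_one]
  | succ m ih => rw [pow_succ, ih, tens_mul_tens, one_mul, pow_succ]

theorem one_tens_pow (v : QCI k a q) (m : ℕ) : tens 1 v ^ m = tens 1 (v ^ m) := by
  induction m with
  | zero => simp [one_tens_one]
  | succ m ih => rw [pow_succ, ih, tens_mul_tens, one_mul, pow_succ']

theorem tens_neg_left (u v : QCI k a q) : tens (-u) v = -tens u v :=
  TensorProduct.neg_tmul u (MulOpposite.op v)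

/-- The linear map `id ⊗ c : A ⊗ Aᵒᵖ → A` for a functional `c`. -/
def envContract (c : QCI k a q →ₗ[k] k) : Env k (QCI k a q) →ₗ[k] QCI k a q :=
  (TensorProduct.rid k (QCI k a q)).toLinearMap ∘ₗ
    LinearMap.lTensor (QCI k a q) (c ∘ₗ (MulOpposite.opLinearEquiv k).symm.toLinearMap)

theorem envContract_tens (c : QCI k a q →ₗ[k] k) (u v : QCI k a q) :
    envContract c (tens u v) = c v • u := rfl

/-- The subgroup `A ⊗ k[v]` of the enveloping algebra. -/
def tensPow (v : QCI k a q) : AddSubgroup (Env k (QCI k a q)) :=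
  AddSubgroup.closure {e | ∃ u i, e = tens u (v ^ i)}

theorem tens_mem_tensPow (v u : QCI k a q) (i : ℕ) : tens u (v ^ i) ∈ tensPow v :=
  AddSubgroup.subset_closure ⟨u, i, rfl⟩

theorem mul_tens_mem_tensPow {v : QCI k a q} {e : Env k (QCI k a q)} (he : e ∈ tensPow v)
    (u : QCI k a q) (i : ℕ) : e * tens u (v ^ i) ∈ tensPow v := by
  induction he using AddSubgroup.closure_induction with
  | mem e he =>
    obtain ⟨u', j, rfl⟩ := he
    rw [tens_mul_tens, ← pow_add]
    exact tens_mem_tensPow _ _ _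
  | zero => rw [zero_mul]; exact AddSubgroup.zero_mem _
  | add e e' _ _ h h' => rw [add_mul]; exact AddSubgroup.add_mem _ h h'
  | neg e _ h => rw [neg_mul]; exact AddSubgroup.neg_mem _ h

theorem eq_sum_of_mem_tensPow {v : QCI k a q} (hv : v ^ a = 0) {c : ℕ → QCI k a q →ₗ[k] k}
    (hc : ∀ i < a, ∀ j, c i (v ^ j) = if j = i then 1 else 0) {e : Env k (QCI k a q)}
    (he : e ∈ tensPow v) : e = ∑ i ∈ Finset.range a, tens (envContract (c i) e) (v ^ i) := by
  induction he using AddSubgroup.closure_induction with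
  | mem e he =>
    obtain ⟨u, j, rfl⟩ := he
    have : ∀ i ∈ Finset.range a, tens (envContract (c i) (tens u (v ^ j))) (v ^ i) =
        if j = i then tens u (v ^ i) else 0 := fun i hi => by
      rw [envContract_tens, hc i (Finset.mem_range.1 hi)]
      split_ifs
      · rw [one_smul]
      · rw [zero_smul, zero_tens]
    rw [Finset.sum_congr rfl this, Finset.sum_ite_eq]
    split_ifs with h
    · rfl
    · rw [pow_eq_zero_of_le (by simpa using h) hv, tens_zero]
  | zero => simp [zero_tens]
  | add e e' _ _ h h' =>
    simp only [map_add, tens_add_left, Finset.sum_add_distrib]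
    rw [← h, ← h']
  | neg e _ h =>
    simp only [map_neg, tens_neg_left, Finset.sum_neg_distrib]
    rw [← h]

/-- The second factor multiplies in the opposite order, so `u ⊗ w^m v^i = (u ⊗ v^i)(1 ⊗ w)^m`. A
basis with the powers of `w` on the left thus yields the decomposition, and contracting with the
dual functional of `w^m v^i` isolates the `v^i`-part of the `m`-th coefficient. -/
theorem isTruncatedPolynomialOver_tensPow {v w : QCI k a q} (hv : v ^ a = 0) (hw : w ^ a = 0)
    (c : ℕ → ℕ → QCI k a q →ₗ[k] k) (hc : ∀ m < a, ∀ i < a, ∀ m' i', c m i (w ^ m' * v ^ i') =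
      if m' = m ∧ i' = i then 1 else 0)
    (hspan : Submodule.span k (Set.range fun p : ℕ × ℕ => w ^ p.1 * v ^ p.2) = ⊤) :
    IsTruncatedPolynomialOver (tensPow v) (tens 1 w) a where
  pow_eq_zero := by rw [one_tens_pow, hw, tens_zero]
  exists_eq z := by
    have hadd : ∀ z z' : Env k (QCI k a q), (∃ e : ℕ → Env k (QCI k a q), (∀ m, e m ∈ tensPow v) ∧
        z = ∑ m ∈ Finset.range a, e m * tens 1 w ^ m) → (∃ e : ℕ → Env k (QCI k a q),
        (∀ m, e m ∈ tensPow v) ∧ z' = ∑ m ∈ Finset.range a, e m * tens 1 w ^ m) →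
        ∃ e : ℕ → Env k (QCI k a q), (∀ m, e m ∈ tensPow v) ∧
        z + z' = ∑ m ∈ Finset.range a, e m * tens 1 w ^ m := by
      rintro _ _ ⟨e, he, rfl⟩ ⟨e', he', rfl⟩
      refine ⟨e + e', fun m => AddSubgroup.add_mem _ (he m) (he' m), ?_⟩
      simp [add_mul, Finset.sum_add_distrib]
    have h0 : ∃ e : ℕ → Env k (QCI k a q), (∀ m, e m ∈ tensPow v) ∧
        0 = ∑ m ∈ Finset.range a, e m * tens 1 w ^ m :=
      ⟨0, fun _ => AddSubgroup.zero_mem _, by simp⟩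
    have ht (u t : QCI k a q) : ∃ e : ℕ → Env k (QCI k a q), (∀ m, e m ∈ tensPow v) ∧
        tens u t = ∑ m ∈ Finset.range a, e m * tens 1 w ^ m := by
      have ht : t ∈ Submodule.span k (Set.range fun p : ℕ × ℕ => w ^ p.1 * v ^ p.2) := by
        rw [hspan]; trivial
      induction ht using Submodule.span_induction generalizing u with
      | mem t ht =>
        obtain ⟨⟨m, i⟩, rfl⟩ := ht
        dsimp only
        by_cases hm : m < a
        · refine ⟨Pi.single m (tens u (v ^ i)), fun j => ?_, ?_⟩
          · rw [Pi.single_apply]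
            split_ifs
            exacts [tens_mem_tensPow _ _ _, AddSubgroup.zero_mem _]
          · rw [Finset.sum_eq_single_of_mem m (Finset.mem_range.2 hm)
              (fun j _ hj => by rw [Pi.single_eq_of_ne hj, zero_mul]), Pi.single_eq_same,
              one_tens_pow, tens_mul_tens, mul_one]
        · rw [pow_eq_zero_of_le (not_lt.1 hm) hw, zero_mul, tens_zero]
          exact h0
      | zero => rwa [tens_zero]
      | add v w _ _ hv hw => rw [tens_add_right]; exact hadd _ _ (hv u) (hw u)
      | smul c v _ hv => rw [tens_smul_right, ← tens_smul_left]; exact hv _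
    exact TensorProduct.induction_on (motive := fun z : Env k (QCI k a q) =>
      ∃ e : ℕ → Env k (QCI k a q), (∀ m, e m ∈ tensPow v) ∧
        z = ∑ m ∈ Finset.range a, e m * tens 1 w ^ m) z h0 (fun u t => ht u t.unop) hadd
  eq_zero e he h0 := by
    have key : ∀ m < a, ∀ i < a, ∀ m', ∀ e ∈ tensPow v,
        envContract (c m i) (e * tens 1 w ^ m') = if m' = m then envContract (c 0 i) e else 0 := by
      intro m hm i hi m' e he
      induction he using AddSubgroup.closure_induction with
      | mem e he =>
        obtain ⟨u, j, rfl⟩ := he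
        have := hc 0 (by omega) i hi 0 j
        rw [pow_zero, one_mul] at this
        rw [one_tens_pow, tens_mul_tens, mul_one, envContract_tens, envContract_tens, hc m hm i hi,
          this]
        by_cases h1 : m' = m <;> by_cases h2 : j = i <;> simp [h1, h2]
      | zero => simp
      | add e e' _ _ h h' =>
        rw [add_mul, map_add, map_add, h, h']
        split_ifs <;> simp
      | neg e _ h =>
        rw [neg_mul, map_neg, map_neg, h]
        split_ifs <;> simp
    intro m hm
    rw [eq_sum_of_mem_tensPow hv (c := c 0) (fun i hi j => by
      have := hc 0 (by omega) i hi 0 j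
      simpa using this) (he m)]
    refine Finset.sum_eq_zero fun i hi => ?_
    have := congrArg (envContract (c m i)) h0
    rw [map_sum, Finset.sum_congr rfl
      (fun m' _ => key m hm i (Finset.mem_range.1 hi) m' (e m') (he m')), Finset.sum_ite_eq',
      if_pos (Finset.mem_range.2 hm), map_zero] at this
    rw [this, zero_tens]

theorem isTruncatedPolynomialOver_y (ha : 0 < a) :
    IsTruncatedPolynomialOver (tensPow (x k a q)) (tens 1 (y k a q)) a :=
  isTruncatedPolynomialOver_tensPow x_pow y_pow (pbwCoord k a q ha)
    (fun _ hm _ hi _ _ => pbwCoord_monomial ha hm hi _ _) span_monomials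

theorem isTruncatedPolynomialOver_x (ha : 0 < a) (hq : q ≠ 0) :
    IsTruncatedPolynomialOver (tensPow (y k a q)) (tens 1 (x k a q)) a := by
  refine isTruncatedPolynomialOver_tensPow y_pow x_pow
    -- Here the basis must be `x^m y^i = q^{mi} y^i x^m`, whence the rescaling of the dual
    -- functionals.
    (fun m i => (q ^ (m * i))⁻¹ • pbwCoord k a q ha i m) (fun m hm i hi m' i' => ?_) ?_
  · rw [x_pow_mul_y_pow, map_smul, LinearMap.smul_apply, pbwCoord_monomial ha hi hm]
    simp only [and_comm (a := i' = i)]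
    split_ifs with h
    · rw [h.1, h.2, smul_smul, mul_inv_cancel₀ (pow_ne_zero _ hq), one_smul]
    · rw [smul_zero, smul_zero]
  · rw [eq_top_iff, ← span_monomials, Submodule.span_le]
    rintro _ ⟨⟨m, i⟩, rfl⟩
    have h : y k a q ^ m * x k a q ^ i =
        (q ^ (i * m))⁻¹ • (x k a q ^ i * y k a q ^ m) := by
      rw [x_pow_mul_y_pow, smul_smul, inv_mul_cancel₀ (pow_ne_zero _ hq), one_smul]
    dsimp only
    rw [h]
    exact Submodule.smul_mem _ _ (Submodule.subset_span ⟨(i, m), rfl⟩)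

theorem mul_tens_one_mem_tensPow {v : QCI k a q} {e : Env k (QCI k a q)} (he : e ∈ tensPow v)
    (u : QCI k a q) : e * tens u 1 ∈ tensPow v := by
  simpa using mul_tens_mem_tensPow he u 0

theorem commute_one_tens_tens_one (u v : QCI k a q) : Commute (tens 1 v) (tens u 1) := by
  rw [Commute, SemiconjBy, tens_mul_tens, tens_mul_tens, one_mul, mul_one, one_mul, mul_one]

theorem tauX_zero_eq : tauX k a q 0 = tens 1 (x k a q) - tens (x k a q) 1 := by
  rw [tauX, pow_zero, one_smul]

theorem gammaX_zero_eq : gammaX k a q 0 =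
    ∑ j ∈ Finset.range a, tens 1 (x k a q) ^ j * tens (x k a q) 1 ^ (a - 1 - j) := by
  simp [gammaX, one_tens_pow, tens_one_pow, tens_mul_tens]

theorem gammaY_eq (s : ℕ) : gammaY k a q s =
    ∑ j ∈ Finset.range a, tens 1 (y k a q) ^ j * tens (q ^ s • y k a q) 1 ^ (a - 1 - j) := by
  rw [gammaY, ← Finset.sum_range_reflect]
  refine Finset.sum_congr rfl fun j hj => ?_
  have := Finset.mem_range.1 hj
  rw [one_tens_pow, tens_one_pow, tens_mul_tens, one_mul, one_mul, smul_pow, tens_smul_left,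
    ← pow_mul, mul_comm, show a - 1 - (a - 1 - j) = j by omega]

theorem exists_eq_mul_tauY (ha : 0 < a) (s : ℕ) {z : Env k (QCI k a q)}
    (hz : z * gammaY k a q s = 0) : ∃ w, z = w * tauY k a q s := by
  rw [gammaY_eq] at hz
  exact (isTruncatedPolynomialOver_y ha).exists_eq_mul_sub ha
    (fun _ he => mul_tens_one_mem_tensPow he _) (commute_one_tens_tens_one _ _)
    (by rw [tens_one_pow, smul_pow, y_pow, smul_zero, zero_tens]) hz

theorem exists_eq_mul_gammaY (ha : 0 < a) (s : ℕ) {z : Env k (QCI k a q)}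
    (hz : z * tauY k a q s = 0) : ∃ w, z = w * gammaY k a q s := by
  rw [gammaY_eq]
  exact (isTruncatedPolynomialOver_y ha).exists_eq_mul_geom_sum
    (fun _ he => mul_tens_one_mem_tensPow he _) (commute_one_tens_tens_one _ _) hz

theorem exists_eq_mul_tauX (ha : 0 < a) (hq : q ≠ 0) {z : Env k (QCI k a q)}
    (hz : z * gammaX k a q 0 = 0) : ∃ w, z = w * tauX k a q 0 := by
  rw [gammaX_zero_eq] at hz
  rw [tauX_zero_eq]
  exact (isTruncatedPolynomialOver_x ha hq).exists_eq_mul_sub ha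
    (fun _ he => mul_tens_one_mem_tensPow he _) (commute_one_tens_tens_one _ _)
    (by rw [tens_one_pow, x_pow, zero_tens]) hz

theorem exists_eq_mul_gammaX (ha : 0 < a) (hq : q ≠ 0) {z : Env k (QCI k a q)}
    (hz : z * tauX k a q 0 = 0) : ∃ w, z = w * gammaX k a q 0 := by
  rw [tauX_zero_eq] at hz
  rw [gammaX_zero_eq]
  exact (isTruncatedPolynomialOver_x ha hq).exists_eq_mul_geom_sum
    (fun _ he => mul_tens_one_mem_tensPow he _) (commute_one_tens_tens_one _ _) hz

theorem exists_eq_add_mul_tauY (ha : 0 < a) (s : ℕ) (z : Env k (QCI k a q)) :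
    ∃ e ∈ tensPow (x k a q), ∃ w, z = e + w * tauY k a q s :=
  (isTruncatedPolynomialOver_y ha).exists_eq_add_mul_sub (commute_one_tens_tens_one _ _)
    (fun _ he => mul_tens_one_mem_tensPow he _) z

theorem eq_zero_of_mem_tensPow_of_eq_mul_tauY (ha : 0 < a) (s : ℕ) {e w : Env k (QCI k a q)}
    (he : e ∈ tensPow (x k a q)) (hw : e = w * tauY k a q s) : e = 0 :=
  (isTruncatedPolynomialOver_y ha).eq_zero_of_eq_mul_sub ha
    (fun _ he => mul_tens_one_mem_tensPow he _) (commute_one_tens_tens_one _ _)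
    (by rw [tens_one_pow, smul_pow, y_pow, smul_zero, zero_tens]) he hw

theorem mul_tauX_mem_tensPow {e : Env k (QCI k a q)} (he : e ∈ tensPow (x k a q)) :
    e * tauX k a q 0 ∈ tensPow (x k a q) := by
  rw [tauX_zero_eq, mul_sub]
  refine AddSubgroup.sub_mem _ ?_ (mul_tens_one_mem_tensPow he _)
  simpa using mul_tens_mem_tensPow he 1 1

theorem mul_gammaX_mem_tensPow {e : Env k (QCI k a q)} (he : e ∈ tensPow (x k a q)) :
    e * gammaX k a q 0 ∈ tensPow (x k a q) := by
  rw [gammaX, Finset.mul_sum]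
  refine AddSubgroup.sum_mem _ fun j _ => ?_
  rw [mul_zero, pow_zero, one_smul]
  exact mul_tens_mem_tensPow he _ _

/-- Exactness of the sequence induced by `γ_x` and `τ_x` on the cokernels of `τ_y`, at the source
of `γ_x`. -/
theorem exists_eq_mul_tauX_add_mul_tauY (ha : 0 < a) (hq : q ^ a = 1) {z w : Env k (QCI k a q)}
    (hz : z * gammaX k a q 0 = w * tauY k a q 1) :
    ∃ u v, z = u * tauX k a q 0 + v * tauY k a q 0 := by
  have hq0 : q ≠ 0 := by rintro rfl; simp [ha.ne'] at hq
  obtain ⟨e, he, v, rfl⟩ := exists_eq_add_mul_tauY ha 0 z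
  -- Moving `τ_y` past `γ_x` turns `v τ_y(0) γ_x(0)` into a multiple of `τ_y(1)`. Then `e γ_x(0)`
  -- lies both in `A ⊗ k[x]` and in the left ideal of `τ_y(1)`, hence is zero.
  rw [add_mul, mul_assoc, tauY_mul_gammaX hq, ← mul_assoc, ← eq_sub_iff_add_eq, ← sub_mul] at hz
  obtain ⟨u, rfl⟩ := exists_eq_mul_tauX ha hq0
    (eq_zero_of_mem_tensPow_of_eq_mul_tauY ha 1 (mul_gammaX_mem_tensPow he) hz)
  exact ⟨u, v, rfl⟩

/-- Exactness of the sequence induced by `γ_x` and `τ_x` on the cokernels of `τ_y`, at the source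
of `τ_x`. -/
theorem exists_eq_mul_gammaX_add_mul_tauY (ha : 0 < a) (hq : q ≠ 0) {z w : Env k (QCI k a q)}
    (hz : z * tauX k a q 0 = w * tauY k a q 0) :
    ∃ u v, z = u * gammaX k a q 0 + v * tauY k a q 1 := by
  obtain ⟨e, he, v, rfl⟩ := exists_eq_add_mul_tauY ha 1 z
  rw [add_mul, mul_assoc, tauY_mul_tauX, ← mul_assoc, ← eq_sub_iff_add_eq, ← sub_mul] at hz
  obtain ⟨u, rfl⟩ := exists_eq_mul_gammaX ha hq
    (eq_zero_of_mem_tensPow_of_eq_mul_tauY ha 0 (mul_tauX_mem_tensPow he) hz)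
  exact ⟨u, v, rfl⟩

/-- Modulo `τ_x(0)` and `τ_y(0)` every element reduces to some `t ⊗ 1`, and `(t ⊗ 1) • 1 = t`. -/
theorem exists_eq_of_smul_one_eq_zero (ha : 0 < a) {z : Env k (QCI k a q)}
    (hz : z • (1 : QCI k a q) = 0) : ∃ u v, z = u * tauX k a q 0 + v * tauY k a q 0 := by
  have key : ∀ e ∈ tensPow (x k a q), ∃ t w, e = tens t 1 + w * tauX k a q 0 := by
    intro e he
    induction he using AddSubgroup.closure_induction with
    | mem e he =>
      obtain ⟨u, i, rfl⟩ := he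
      refine ⟨u * x k a q ^ i, tens u 1 * ∑ j ∈ Finset.range i,
        tens 1 (x k a q) ^ j * tens (x k a q) 1 ^ (i - 1 - j), ?_⟩
      rw [tauX_zero_eq, mul_assoc, (commute_one_tens_tens_one _ _).geom_sum₂_mul, mul_sub,
        one_tens_pow, tens_one_pow, tens_mul_tens, tens_mul_tens]
      simp
    | zero => exact ⟨0, 0, by simp [zero_tens]⟩
    | add e e' _ _ h h' =>
      obtain ⟨t, w, rfl⟩ := h
      obtain ⟨t', w', rfl⟩ := h'
      exact ⟨t + t', w + w', by rw [tens_add_left, add_mul]; abel⟩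
    | neg e _ h =>
      obtain ⟨t, w, rfl⟩ := h
      exact ⟨-t, -w, by rw [tens_neg_left, neg_mul]; abel⟩
  obtain ⟨e, he, v, rfl⟩ := exists_eq_add_mul_tauY ha 0 z
  obtain ⟨t, u, rfl⟩ := key e he
  have htx : tauX k a q 0 • (1 : QCI k a q) = 0 := by
    simp [tauX, sub_smul, tens_smul]
  have hty : tauY k a q 0 • (1 : QCI k a q) = 0 := by
    simp [tauY, sub_smul, tens_smul]
  rw [add_smul, add_smul, mul_smul, mul_smul, htx, hty, smul_zero, smul_zero, add_zero, add_zero,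
    tens_smul, mul_one, mul_one] at hz
  exact ⟨u, v, by rw [hz, zero_tens, zero_add]⟩

end

end HochschildQCI

/-! ### Exactness of the augmented complex `P` -/

section

open CategoryTheory

/-- A criterion for an augmented complex of modules to be a resolution. -/
theorem ChainComplex.quasiIso_of_toSingle₀ {R : Type*} [Ring R] {K : ChainComplex (ModuleCat R) ℕ}
    {X : ModuleCat R} (f : K ⟶ (ChainComplex.single₀ (ModuleCat R)).obj X) (g : K.X 0 ⟶ X)
    (hg : f.f 0 = g) (hsurj : Function.Surjective g)
    (h0 : ∀ z, g z = 0 → ∃ w, K.d 1 0 w = z)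
    (hd : ∀ n z, K.d (n + 1) n z = 0 → ∃ w, K.d (n + 2) (n + 1) w = z) : QuasiIso f where
  quasiIsoAt m := by
    induction m with
    | zero =>
      rw [ChainComplex.quasiIsoAt₀_iff, ShortComplex.quasiIso_iff_of_zeros' _
        (K.shape _ _ (by simp)) rfl rfl]
      subst hg
      constructor
      · rw [ShortComplex.moduleCat_exact_iff]
        exact h0
      · rw [ModuleCat.epi_iff_surjective]
        exact hsurj
    | succ m _ =>
      rw [quasiIsoAt_iff_exactAt' (hL := ChainComplex.exactAt_succ_single_obj ..),
          HomologicalComplex.exactAt_iff' _ (m + 2) (m + 1) m (by simp) (by simp),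
          ShortComplex.moduleCat_exact_iff]
      exact hd m

end

namespace HochschildQCI

open CategoryTheory

noncomputable section

variable {k : Type u} [Field k] {a : ℕ} {q : k}

theorem diff_apply (n : ℕ) (z : P k a q (n + 1)) (j : Fin (n + 1)) :
    diff k a q n z j = z j.castSucc * coeffY k a q (n + 1) (j : ℕ) +
      z j.succ * coeffX k a q (n + 1) ((j : ℕ) + 1) := by
  rw [diff, Module.Basis.constr_apply_fintype]
  simp only [Pi.basisFun_equivFun, LinearEquiv.refl_apply, Finset.sum_apply, Pi.smul_apply,
    Pi.add_apply, smul_eq_mul, mul_add, Finset.sum_add_distrib, gen]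
  congr 1
  · rw [Finset.sum_eq_single j.castSucc]
    · simp
    · intro i _ hi
      rw [if_neg, mul_zero, mul_zero]
      rw [Ne, Fin.ext_iff, Fin.val_castSucc] at hi
      omega
    · simp
  · rw [Finset.sum_eq_single j.succ]
    · simp
    · intro i _ hi
      rw [if_neg, mul_zero, mul_zero]
      rw [Ne, Fin.ext_iff, Fin.val_succ] at hi
      omega
    · simp

/-- Exactness within a column: raising `n` by one swaps `τ_y(s)` and `γ_y(s)`, up to sign, with the
same `s`. -/
theorem exists_eq_mul_coeffY (ha : 0 < a) (n : ℕ) (i : ℤ) {z : Env k (QCI k a q)}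
    (hz : z * coeffY k a q n i = 0) : ∃ w, z = w * coeffY k a q (n + 1) i := by
  by_cases hn : Even n <;> by_cases hi : Even i <;>
    simp only [coeffY, hn, hi, Nat.even_add_one, if_true, if_false, not_true, not_false_eq_true]
      at hz ⊢
  · exact exists_eq_mul_tauY ha 0 hz
  · rw [mul_neg, neg_eq_zero] at hz
    obtain ⟨w, rfl⟩ := exists_eq_mul_gammaY ha 1 hz
    exact ⟨-w, by rw [neg_mul_neg]⟩
  · exact exists_eq_mul_gammaY ha 0 hz
  · rw [mul_neg, neg_eq_zero] at hz
    obtain ⟨w, rfl⟩ := exists_eq_mul_tauY ha 1 hz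
    exact ⟨-w, by rw [neg_mul_neg]⟩

/-- Exactness along the diagonal `i = n`, where `coeffY` is `τ_y` up to sign, so the statement
concerns the cokernels of `τ_y`. Only `γ_x(0)` and `τ_x(0)` occur there as `coeffX`. -/
theorem exists_eq_mul_coeffX_add_mul_coeffY (ha : 0 < a) (hq : q ^ a = 1) (n : ℕ)
    {z w : Env k (QCI k a q)}
    (hz : w * coeffY k a q (n + 1) n + z * coeffX k a q (n + 1) (n + 1) = 0) :
    ∃ u v, z = v * coeffY k a q (n + 2) (n + 1) + u * coeffX k a q (n + 2) (n + 2) := by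
  have hq0 : q ≠ 0 := by rintro rfl; simp [ha.ne'] at hq
  by_cases hn : Even n
  · have h1 : ¬ Even (n + 1) := by simpa [Nat.even_add_one] using hn
    have h2 : Even (n + 2) := by simpa [Nat.even_add] using hn
    have h1' : ¬ Even ((n : ℤ) + 1) := by exact_mod_cast h1
    have h2' : Even ((n : ℤ) + 2) := by exact_mod_cast h2
    have h0' : Even (n : ℤ) := by exact_mod_cast hn
    simp only [coeffX, coeffY, h1, h2, h1', h2', h0', if_true, if_false] at hz ⊢
    obtain ⟨u, v, rfl⟩ := exists_eq_mul_gammaX_add_mul_tauY ha hq0 (w := -w) (z := z)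
      (by rw [neg_mul]; exact eq_neg_of_add_eq_zero_right hz)
    exact ⟨u, -v, by rw [neg_mul_neg, add_comm]⟩
  · have h1 : Even (n + 1) := by simpa [Nat.even_add_one] using hn
    have h2 : ¬ Even (n + 2) := by simpa [Nat.even_add] using hn
    have h1' : Even ((n : ℤ) + 1) := by exact_mod_cast h1
    have h2' : ¬ Even ((n : ℤ) + 2) := by exact_mod_cast h2
    have h0' : ¬ Even (n : ℤ) := by exact_mod_cast hn
    simp only [coeffX, coeffY, h1, h2, h1', h2', h0', if_true, if_false] at hz ⊢
    rw [mul_neg] at hz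
    obtain ⟨u, v, rfl⟩ := exists_eq_mul_tauX_add_mul_tauY ha hq (w := w) (z := z)
      (eq_of_sub_eq_zero (by rw [sub_eq_neg_add]; exact hz))
    exact ⟨u, v, by rw [add_comm]⟩

theorem diff_diff_apply (hq : q ^ a = 1) (n : ℕ) (w : P k a q (n + 2)) :
    diff k a q n (diff k a q (n + 1) w) = 0 :=
  LinearMap.congr_fun (diff_comp_diff hq n) w

/-- A cycle supported in the columns of index less than `r ≤ n + 1` is a boundary. -/
theorem exists_diff_eq_of_support (ha : 0 < a) (hq : q ^ a = 1) (n r : ℕ) (hr : r ≤ n + 1)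
    (z : P k a q (n + 1)) (hz : diff k a q n z = 0) (h0 : ∀ i : Fin (n + 2), r ≤ i → z i = 0) :
    ∃ w, diff k a q (n + 1) w = z := by
  induction r generalizing z with
  | zero => exact ⟨0, by rw [map_zero]; exact (funext fun i => h0 i (Nat.zero_le _)).symm⟩
  | succ r ih =>
    -- The component of index `r` of `d z` involves only `z_r` and `z_{r+1} = 0`, so column
    -- exactness writes `z_r` as a boundary coefficient. Subtracting that boundary changes only the
    -- indices `r` and `r - 1`, leaving a cycle supported below `r`.
    have h1 := diff_apply n z ⟨r, by omega⟩
    rw [hz, h0 (Fin.succ ⟨r, by omega⟩) (by simp), zero_mul, add_zero] at h1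
    obtain ⟨w, hw⟩ := exists_eq_mul_coeffY ha _ _ h1.symm
    obtain ⟨w', hw'⟩ := ih (by omega) (z - diff k a q (n + 1) (Pi.single ⟨r, by omega⟩ w))
      (by rw [map_sub, hz, diff_diff_apply hq, sub_zero]) (fun i hi => by
        rw [Pi.sub_apply, diff_apply]
        rw [Pi.single_eq_of_ne (i' := i.succ) (by rw [Ne, Fin.ext_iff]; simp; omega), zero_mul,
          add_zero]
        rcases hi.eq_or_lt with h | h
        · rw [show i = ⟨r, by omega⟩ from Fin.ext h.symm]
          exact sub_eq_zero.2 (hw.trans (congrArg (· * _)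
            (Pi.single_eq_same (M := fun _ => Env k (QCI k a q)) (⟨r, by omega⟩ : Fin (n + 3)) w).symm))
        · rw [h0 i h, Pi.single_eq_of_ne (by rw [Ne, Fin.ext_iff]; simp; omega), zero_mul, sub_zero])
    exact ⟨w' + Pi.single ⟨r, by omega⟩ w, by rw [map_add, hw', sub_add_cancel]⟩

theorem exists_diff_eq (ha : 0 < a) (hq : q ^ a = 1) (n : ℕ) (z : P k a q (n + 1))
    (hz : diff k a q n z = 0) : ∃ w, diff k a q (n + 1) w = z := by
  have h1 := diff_apply n z (Fin.last n)
  rw [hz] at h1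
  obtain ⟨u, v, huv⟩ := exists_eq_mul_coeffX_add_mul_coeffY ha hq n h1.symm
  -- Index `n + 1` has no counterpart in `P_n`, so column exactness does not reach it. It is cleared
  -- using `f_{n+1}` and `f_{n+2}`, the two generators of `P_{n+2}` whose boundaries involve it.
  set w₀ : P k a q (n + 2) := Pi.single (Fin.last (n + 1)).castSucc v + Pi.single (Fin.last (n + 2)) u
    with hw₀
  obtain ⟨w, hw⟩ := exists_diff_eq_of_support ha hq n (n + 1) le_rfl (z - diff k a q (n + 1) w₀)
      (by rw [map_sub, hz, diff_diff_apply hq, sub_zero]) (fun i hi => by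
        obtain rfl : i = Fin.last (n + 1) := Fin.ext (by simp; omega)
        rw [Pi.sub_apply, diff_apply, hw₀, Pi.add_apply, Pi.add_apply, Pi.single_eq_same,
          Fin.succ_last, Pi.single_eq_same, Pi.single_eq_of_ne (Fin.castSucc_ne_last _),
          Pi.single_eq_of_ne (Fin.castSucc_ne_last _).symm, add_zero, zero_add, sub_eq_zero]
        refine huv.trans ?_
        rw [Fin.val_last]
        push_cast
        rw [add_assoc (n : ℤ) 1 1]
        rfl)
  exact ⟨w + w₀, by rw [map_add, hw, sub_add_cancel]⟩

theorem exists_diff_zero_eq (ha : 0 < a) (z : P k a q 0) (hz : zetaMap k a q 0 0 z = 0) :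
    ∃ w, diff k a q 0 w = z := by
  rw [zetaMap, Module.Basis.constr_apply_fintype] at hz
  obtain ⟨u, v, huv⟩ := exists_eq_of_smul_one_eq_zero ha (z := z 0) (by simpa using hz)
  -- `d_1` sends `f_0` to `τ_y(0) f_0` and `f_1` to `τ_x(0) f_0`, hence the order `v`, `u`.
  refine ⟨![v, u], funext fun i => ?_⟩
  obtain rfl : i = 0 := Fin.fin_one_eq_zero i
  rw [diff_apply, huv]
  simp [coeffX, coeffY, add_comm]

theorem complexP_d (hq : q ^ a = 1) (n : ℕ) :
    (complexP hq).d (n + 1) n = ModuleCat.ofHom (diff k a q n) :=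
  ChainComplex.of_d (fun n => ModuleCat.of _ (P k a q n)) (fun n => ModuleCat.ofHom (diff k a q n)) n

theorem augmentation_f_zero (ha : 3 ≤ a) (hq : IsPrimitiveRoot q a) :
    (augmentation ha hq).f 0 = zetaHom hq.pow_eq_one 0 0 :=
  ChainComplex.toSingle₀Equiv_symm_apply_f_zero _ _

theorem zetaHom_zero_surjective (hq : q ^ a = 1) : Function.Surjective (zetaHom hq 0 0) := by
  intro c
  refine ⟨tens c 1 • gen k a q 0 0, ?_⟩
  refine (map_smul (zetaMap k a q 0 0) (tens c 1) (gen k a q 0 0)).trans ?_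
  rw [zetaMap_gen 0 0 le_rfl]
  simp [tens_smul]

theorem quasiIso_augmentation (ha : 3 ≤ a) (hq : IsPrimitiveRoot q a) :
    QuasiIso (augmentation ha hq) := by
  have ha' : 0 < a := by omega
  refine ChainComplex.quasiIso_of_toSingle₀ _ _ (augmentation_f_zero ha hq)
    (zetaHom_zero_surjective hq.pow_eq_one) (fun z hz => ?_) (fun n z hz => ?_)
  · rw [complexP_d]
    exact exists_diff_zero_eq ha' z hz
  · rw [complexP_d] at hz ⊢
    exact exists_diff_eq ha' hq.pow_eq_one n z hz

end

end HochschildQCI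

/-! ### Products of the classes `ζ` -/

namespace HochschildQCI

noncomputable section

variable {k : Type u} [Field k] {a : ℕ} {q : k}

theorem coeffY_congr {n n' : ℕ} {i i' : ℤ} (hn : Even n ↔ Even n') (hi : Even i ↔ Even i') :
    coeffY k a q n i = coeffY k a q n' i' := by
  simp only [coeffY, hn, hi]

theorem coeffX_congr {n n' : ℕ} {i i' : ℤ} (hn : Even n ↔ Even n') (hi : Even i ↔ Even i') :
    coeffX k a q n i = coeffX k a q n' i' := by
  simp only [coeffX, hn, hi]

theorem zetaMap_apply {n j : ℕ} (hj : j ≤ n) (z : P k a q n) :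
    zetaMap k a q n j z = z ⟨j, by omega⟩ • (1 : QCI k a q) := by
  rw [zetaMap, Module.Basis.constr_apply_fintype, Finset.sum_eq_single ⟨j, by omega⟩]
  · simp
  · intro i _ hi
    rw [if_neg (by rwa [Ne, Fin.ext_iff] at hi), smul_zero]
  · simp

variable (k a q) in
/-- The map `P_{n+m} → P_m`, `f_j ↦ f_{j-i}`, for `i ≤ n`. -/
def shiftMap {n i : ℕ} (hi : i ≤ n) (m : ℕ) : P k a q (n + m) →ₗ[Env k (QCI k a q)] P k a q m :=
  LinearMap.funLeft _ _ fun l => ⟨l + i, by omega⟩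

/-- The coefficients of the differential see only the parities of degree and index, which an even
shift preserves. -/
theorem shiftMap_diff {n i : ℕ} (hi : i ≤ n) (hn : Even n) (hi' : Even i) (m : ℕ)
    (z : P k a q (n + (m + 1))) :
    shiftMap k a q hi m (diff k a q (n + m) z) = diff k a q m (shiftMap k a q hi (m + 1) z) := by
  funext l
  refine (diff_apply (n + m) z ⟨l + i, by omega⟩).trans ((diff_apply m _ l).trans ?_).symm
  have hi'' : Even (i : ℤ) := by exact_mod_cast hi'
  have hl : Even ((l + i : ℕ) : ℤ) ↔ Even ((l : ℕ) : ℤ) := by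
    rw [Nat.cast_add, Int.even_add]
    exact iff_true_right hi''
  have hm : Even (n + m + 1) ↔ Even (m + 1) := by
    rw [add_assoc, Nat.even_add]
    exact iff_true_left hn
  rw [coeffY_congr hm hl, coeffX_congr hm (i' := (l : ℕ) + 1)
    (by rw [Int.even_add_one, Int.even_add_one, hl])]
  have e : (⟨l + i, by omega⟩ : Fin (n + m + 1)).succ =
      (⟨l + 1 + i, by omega⟩ : Fin (n + m + 2)) := Fin.ext (by simp; omega)
  rw [e]
  rfl

open CategoryTheory CategoryTheory.Abelian

/-- The class of `ζ_j` in `Ext^n`. -/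
def zetaExt (ha : 3 ≤ a) (hq : IsPrimitiveRoot q a) (h : QuasiIso (augmentation ha hq))
    (n j : ℕ) (hn : Even n) (hj : j ≤ n) : SelfExt (regular k (QCI k a q)) n :=
  (resolution ha hq h).extMk (zetaHom hq.pow_eq_one n j) (n + 1) rfl
      (d_comp_zetaHom ha hq n j hn hj)

/-- Multiplying by the class of `ζ_i`, for `i` even, shifts the index of cocycles by `i`. -/
theorem zetaExt_comp_extMk (ha : 3 ≤ a) (hq : IsPrimitiveRoot q a)
    (h : QuasiIso (augmentation ha hq)) {n i m : ℕ} (hn : Even n) (hi : i ≤ n) (hi' : Even i)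
    (g : (complexP hq.pow_eq_one).X m ⟶ regular k (QCI k a q))
    (hg : (complexP hq.pow_eq_one).d (m + 1) m ≫ g = 0)
    (f : (complexP hq.pow_eq_one).X (n + m) ⟶ regular k (QCI k a q))
    (hf : (complexP hq.pow_eq_one).d (n + m + 1) (n + m) ≫ f = 0)
    (hfg : ∀ z : P k a q (n + m), f z = g (shiftMap k a q hi m z)) :
    Ext.comp (zetaExt ha hq h n i hn hi) ((resolution ha hq h).extMk g (m + 1) rfl hg) rfl =
      (resolution ha hq h).extMk f (n + m + 1) rfl hf := by
  obtain rfl : f = ModuleCat.ofHom (shiftMap k a q hi m) ≫ g := by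
    ext z
    exact hfg z
  refine ProjectiveResolution.extMk_comp_extMk (resolution ha hq h) (resolution ha hq h)
    (zetaHom hq.pow_eq_one n i) _ g hg (fun m => ModuleCat.ofHom (shiftMap k a q hi m))
    (fun m => ?_) ?_ hf
  · rw [Int.negOnePow_even _ (by exact_mod_cast hn), one_smul]
    refine (congrArg (_ ≫ ·) (complexP_d hq.pow_eq_one m)).trans
      (Eq.trans ?_ (congrArg (· ≫ _) (complexP_d hq.pow_eq_one (n + m))).symm)
    ext z
    exact (shiftMap_diff hi hn hi' m z).symm
  · refine (congrArg (_ ≫ ·) (augmentation_f_zero ha hq)).trans ?_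
    ext z
    refine (zetaMap_apply le_rfl _).trans ((zetaMap_apply hi z).trans ?_).symm
    exact congrArg (· • (1 : QCI k a q)) (congrArg z (Fin.ext (zero_add i).symm))

theorem zetaExt_comp_zetaExt (ha : 3 ≤ a) (hq : IsPrimitiveRoot q a)
    (h : QuasiIso (augmentation ha hq)) {n i m j : ℕ} (hn : Even n) (hi : i ≤ n) (hi' : Even i)
    (hm : Even m) (hj : j ≤ m) :
    Ext.comp (zetaExt ha hq h n i hn hi) (zetaExt ha hq h m j hm hj) rfl =
      zetaExt ha hq h (n + m) (i + j) (hn.add hm) (by omega) := by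
  refine zetaExt_comp_extMk ha hq h hn hi hi' _ _ _ _ fun z => ?_
  refine (zetaMap_apply (by omega) z).trans ((zetaMap_apply hj _).trans ?_).symm
  refine congrArg (· • (1 : QCI k a q)) (congrArg z (Fin.ext ?_))
  exact add_comm j i

theorem zetaExt_zero (ha : 3 ≤ a) (hq : IsPrimitiveRoot q a) (h : QuasiIso (augmentation ha hq)) :
    zetaExt ha hq h 0 0 Even.zero le_rfl = Ext.mk₀ (𝟙 _) := by
  obtain ⟨g, hg, hg'⟩ := (resolution ha hq h).extMk_surjective (Ext.mk₀ (𝟙 _)) 1 rfl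
  -- The shift attached to `ζ_0^0` is the identity, so `ζ_0^0` fixes every cocycle class on its
  -- right; apply this to a cocycle representing the identity.
  refine (Ext.comp_mk₀_id _).symm.trans (Eq.trans ?_ hg')
  rw [← hg']
  exact zetaExt_comp_extMk ha hq h Even.zero le_rfl Even.zero g hg g hg fun z => rfl

end

end HochschildQCI

/-! ### Linear independence of the classes `ζ` in positive degree -/

namespace HochschildQCI

open CategoryTheory CategoryTheory.Abelian

noncomputable section

variable {k : Type u} [Field k] {a : ℕ} {q : k}

variable (k a q) in
/-- The augmentation `A → k`, `x, y ↦ 0`. -/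
def counit (ha : a ≠ 0) : QCI k a q →ₐ[k] k :=
  RingQuot.liftAlgHom k ⟨FreeAlgebra.lift k 0, by rintro _ _ (_ | _ | _) <;> simp [ha]⟩

theorem counit_x (ha : a ≠ 0) : counit k a q ha (x k a q) = 0 :=
  (RingQuot.liftAlgHom_mkAlgHom_apply k _ _ _).trans (by simp)

theorem counit_y (ha : a ≠ 0) : counit k a q ha (y k a q) = 0 :=
  (RingQuot.liftAlgHom_mkAlgHom_apply k _ _ _).trans (by simp)

theorem counit_tens_smul (ha : a ≠ 0) (u v w : QCI k a q) :
    counit k a q ha (tens u v • w) = counit k a q ha u * counit k a q ha v * counit k a q ha w := by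
  rw [tens_smul, map_mul, map_mul]
  ring

theorem counit_tauX_smul (ha : a ≠ 0) (s : ℕ) (w : QCI k a q) :
    counit k a q ha (tauX k a q s • w) = 0 := by
  simp [tauX, sub_smul, env_smul_smul, counit_tens_smul, counit_x]

theorem counit_tauY_smul (ha : a ≠ 0) (s : ℕ) (w : QCI k a q) :
    counit k a q ha (tauY k a q s • w) = 0 := by
  simp [tauY, sub_smul, env_smul_smul, counit_tens_smul, counit_y]

theorem counit_gammaX_smul (ha : 2 ≤ a) (s : ℕ) (w : QCI k a q) :
    counit k a q (by omega) (gammaX k a q s • w) = 0 := by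
  rw [gammaX, Finset.sum_smul, map_sum]
  refine Finset.sum_eq_zero fun j hj => ?_
  have := Finset.mem_range.1 hj
  rw [env_smul_smul, map_smul, counit_tens_smul, map_pow, map_pow, counit_x, ← pow_add,
    zero_pow (by omega), zero_mul, smul_zero]

theorem counit_gammaY_smul (ha : 2 ≤ a) (s : ℕ) (w : QCI k a q) :
    counit k a q (by omega) (gammaY k a q s • w) = 0 := by
  rw [gammaY, Finset.sum_smul, map_sum]
  refine Finset.sum_eq_zero fun j hj => ?_
  have := Finset.mem_range.1 hj
  rw [env_smul_smul, map_smul, counit_tens_smul, map_pow, map_pow, counit_y, ← pow_add,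
    zero_pow (by omega), zero_mul, smul_zero]

theorem counit_coeffY_smul (ha : 2 ≤ a) (n : ℕ) (i : ℤ) (w : QCI k a q) :
    counit k a q (by omega) (coeffY k a q n i • w) = 0 := by
  rw [coeffY]
  split_ifs <;> simp [neg_smul, counit_gammaY_smul ha, counit_tauY_smul]

theorem counit_coeffX_smul (ha : 2 ≤ a) (n : ℕ) (i : ℤ) (w : QCI k a q) :
    counit k a q (by omega) (coeffX k a q n i • w) = 0 := by
  rw [coeffX]
  split_ifs <;> simp [counit_gammaX_smul ha, counit_tauX_smul]

/-- Minimality of `P`: every coefficient of the differential acts with values in the augmentation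
ideal. For `γ` this needs `a ≥ 2`, its terms having total degree `a - 1`. -/
theorem counit_apply_diff_gen (ha : 2 ≤ a) (n : ℕ) (i : ℤ)
    (g : P k a q n →ₗ[Env k (QCI k a q)] QCI k a q) :
    counit k a q (by omega) (g (diff k a q n (gen k a q (n + 1) i))) = 0 := by
  rw [diff_gen, map_add, map_smul, map_smul, map_add, counit_coeffX_smul ha, counit_coeffY_smul ha,
    add_zero]

/-- Provides one cocycle for a whole linear combination, while recording its values modulo the
augmentation ideal. The map `J` may repeat indices, so coefficients are summed over its fibres. -/
theorem exists_extMk_eq_sum (ha : 3 ≤ a) (hq : IsPrimitiveRoot q a)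
    (h : QuasiIso (augmentation ha hq)) {n : ℕ} (hn : Even n) {ι : Type*} (s : Finset ι)
    (c : ι → k) (J : ι → ℕ) (hJ : ∀ i, J i ≤ n) :
    ∃ (f : (complexP hq.pow_eq_one).X n ⟶ regular k (QCI k a q))
      (hf : (complexP hq.pow_eq_one).d (n + 1) n ≫ f = 0),
      ∑ i ∈ s, c i • zetaExt ha hq h n (J i) hn (hJ i) =
        (resolution ha hq h).extMk f (n + 1) rfl hf ∧
      ∀ j, counit k a q (by omega) (f (gen k a q n j)) = ∑ i ∈ s with J i = j, c i := by
  classical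
  induction s using Finset.induction_on with
  | empty =>
    refine ⟨0, Limits.comp_zero, ?_, fun j => map_zero _⟩
    exact ((resolution ha hq h).extMk_zero (n + 1) rfl).symm
  | insert i s hi ih =>
    obtain ⟨f, hf, hs, hj⟩ := ih
    let g : (complexP hq.pow_eq_one).X n ⟶ regular k (QCI k a q) :=
      zetaHom hq.pow_eq_one n (J i) ≫ (c i • 𝟙 _)
    have hg : (complexP hq.pow_eq_one).d (n + 1) n ≫ g = 0 := by
      rw [← Category.assoc, d_comp_zetaHom ha hq n (J i) hn (hJ i), Limits.zero_comp]
    refine ⟨g + f, by rw [Preadditive.comp_add, hf, hg, add_zero], ?_, fun j => ?_⟩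
    · rw [Finset.sum_insert hi, hs]
      refine Eq.trans ?_ ((resolution ha hq h).add_extMk g f (n + 1) rfl hg hf)
      refine congrArg₂ (fun u v : SelfExt (regular k (QCI k a q)) n => u + v) ?_ rfl
      refine (Ext.smul_eq_comp_mk₀ _ _).trans ?_
      exact (resolution ha hq h).extMk_comp_mk₀ _ _ _ _ _
    · have h1 : (g + f) (gen k a q n j) =
          algebraMap k (Env k (QCI k a q)) (c i) • zetaMap k a q n (J i) (gen k a q n j) +
            f (gen k a q n j) := rfl
      rw [Finset.filter_insert]
      refine (congrArg _ h1).trans ?_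
      rw [map_add, hj, zetaMap_gen _ _ (hJ i)]
      have h2 (w : QCI k a q) : algebraMap k (Env k (QCI k a q)) (c i) • w = c i • w := by
        rw [Algebra.algebraMap_eq_smul_one, env_smul_smul, one_smul]
      rw [h2, map_smul]
      by_cases hij : j = J i
      · rw [if_pos hij, if_pos hij.symm, Finset.sum_insert (by simp [hi]), map_one, smul_eq_mul,
          mul_one]
      · rw [if_neg hij, if_neg (Ne.symm hij), map_zero, smul_zero, zero_add]

/-- In positive degree, the classes `ζ_j` are linearly independent. -/
theorem sum_filter_eq_zero (ha : 3 ≤ a) (hq : IsPrimitiveRoot q a)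
    (h : QuasiIso (augmentation ha hq)) {n : ℕ} (hn : Even n) (hn0 : n ≠ 0) {ι : Type*}
    (s : Finset ι) (c : ι → k) (J : ι → ℕ) (hJ : ∀ i, J i ≤ n)
    (h0 : ∑ i ∈ s, c i • zetaExt ha hq h n (J i) hn (hJ i) = 0) (j : ℕ) :
    ∑ i ∈ s with J i = j, c i = 0 := by
  obtain ⟨f, hf, hs, hj⟩ := exists_extMk_eq_sum ha hq h hn s c J hJ
  -- In positive degree a vanishing class means that `f` factors through the differential, so its
  -- values on the generators die in `k`.
  obtain ⟨p, rfl⟩ := Nat.exists_eq_succ_of_ne_zero hn0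
  obtain ⟨g, rfl⟩ := ((resolution ha hq h).extMk_eq_zero_iff f _ rfl hf p rfl).1 (hs.symm.trans h0)
  have := counit_apply_diff_gen (by omega : 2 ≤ a) p j g.hom
  refine Eq.trans ?_ this
  have e := hj j
  simp only [Nat.cast_inj] at e
  rw [← e]
  refine congrArg _ (congrArg g.hom ?_)
  exact ConcreteCategory.congr_hom (complexP_d hq.pow_eq_one p) _

end

end HochschildQCI

/-! ### The isomorphism with the polynomial ring -/

namespace HochschildQCI

open CategoryTheory CategoryTheory.Abelian

noncomputable section

variable {k : Type u} [Field k] {a : ℕ} {q : k}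

theorem of_zetaExt_congr (ha : 3 ≤ a) (hq : IsPrimitiveRoot q a)
    (h : QuasiIso (augmentation ha hq)) {n n' j j' : ℕ} (hn : Even n) (hj : j ≤ n)
    (en : n = n') (ej : j = j') :
    DirectSum.of (SelfExt (regular k (QCI k a q))) n (zetaExt ha hq h n j hn hj) =
      DirectSum.of (SelfExt (regular k (QCI k a q))) n'
        (zetaExt ha hq h n' j' (en ▸ hn) (en ▸ ej ▸ hj)) := by
  subst en
  subst ej
  rfl

/-- The monomials `ζ_0^α ζ_2^β = ζ_{2β}` of degree `2 (α + β)`. -/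
def zetaMonomial (ha : 3 ≤ a) (hq : IsPrimitiveRoot q a) (h : QuasiIso (augmentation ha hq)) :
    Multiplicative (Fin 2 →₀ ℕ) →* HH k (QCI k a q) where
  toFun d := zeta ha hq h (d.toAdd 0 + d.toAdd 1) (2 * d.toAdd 1) (by omega)
  map_one' := congrArg (DirectSum.of (SelfExt (regular k (QCI k a q))) 0) (zetaExt_zero ha hq h)
  map_mul' d e := by
    refine Eq.symm ((DirectSum.of_mul_of _ _).trans ?_)
    refine (congrArg _ (zetaExt_comp_zetaExt ha hq h (even_two_mul _) (by omega)
      (even_two_mul _) (even_two_mul _) (by omega))).trans ?_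
    refine of_zetaExt_congr ha hq h _ (by omega) ?_ ?_
    · simp only [toAdd_mul, Finsupp.add_apply]
      ring
    · simp only [toAdd_mul, Finsupp.add_apply]
      ring

/-- The algebra map `k[X_0, X_1] → HH^*(A)`, `X_0 ↦ ζ_0^2`, `X_1 ↦ ζ_2^2`. -/
def zetaAlgHom (ha : 3 ≤ a) (hq : IsPrimitiveRoot q a) (h : QuasiIso (augmentation ha hq)) :
    MvPolynomial (Fin 2) k →ₐ[k] HH k (QCI k a q) :=
  AddMonoidAlgebra.lift k (HH k (QCI k a q)) (Fin 2 →₀ ℕ) (zetaMonomial ha hq h)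

theorem zetaAlgHom_apply (ha : 3 ≤ a) (hq : IsPrimitiveRoot q a)
    (h : QuasiIso (augmentation ha hq)) (p : MvPolynomial (Fin 2) k) :
    zetaAlgHom ha hq h p = ∑ d ∈ p.support, p.coeff d •
      zeta ha hq h (d 0 + d 1) (2 * d 1) (by omega) :=
  AddMonoidAlgebra.lift_apply _ _

theorem zetaAlgHom_monomial (ha : 3 ≤ a) (hq : IsPrimitiveRoot q a)
    (h : QuasiIso (augmentation ha hq)) (d : Fin 2 →₀ ℕ) (c : k) :
    zetaAlgHom ha hq h (MvPolynomial.monomial d c) =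
      c • zeta ha hq h (d 0 + d 1) (2 * d 1) (by omega) :=
  AddMonoidAlgebra.lift_single _ _ _

/-- The cohomological degree recovers `α + β` and the index of `ζ` recovers `β`, so distinct
monomials go to distinct `ζ`. -/
theorem coeff_eq_zero_of_zetaAlgHom_eq_zero (ha : 3 ≤ a) (hq : IsPrimitiveRoot q a)
    (h : QuasiIso (augmentation ha hq)) (p : MvPolynomial (Fin 2) k)
    (hp : zetaAlgHom ha hq h p = 0) (d : Fin 2 →₀ ℕ) (hd : d ≠ 0) : p.coeff d = 0 := by
  set n := 2 * (d 0 + d 1) with hn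
  have hcomp (e : Fin 2 →₀ ℕ) :
      DirectSum.component k ℕ (SelfExt (regular k (QCI k a q))) n
        (zeta ha hq h (e 0 + e 1) (2 * e 1) (by omega)) =
      if e 0 + e 1 = d 0 + d 1 then
        -- The index must be at most `n` for every exponent `e`, not only those of the right total
        -- degree; for the latter the minimum is `2 * e 1`.
        zetaExt ha hq h n (min (2 * e 1) n) (even_two_mul _) (min_le_right _ _) else 0 := by
    split_ifs with he
    · refine (congrArg (DirectSum.component k ℕ (SelfExt (regular k (QCI k a q))) n)
        (of_zetaExt_congr ha hq h (even_two_mul (e 0 + e 1)) (by omega : 2 * e 1 ≤ _)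
          (by rw [he]) (by omega : 2 * e 1 = min (2 * e 1) n))).trans ?_
      exact DirectSum.of_eq_same _ _
    · exact DirectSum.of_eq_of_ne _ _ _ (by omega)
  have h1 := congrArg (DirectSum.component k ℕ (SelfExt (regular k (QCI k a q))) n) hp
  rw [zetaAlgHom_apply, map_sum, map_zero] at h1
  simp only [map_smul, hcomp, smul_ite, smul_zero] at h1
  rw [← Finset.sum_filter] at h1
  have h2 := sum_filter_eq_zero ha hq h (even_two_mul _) (fun h0 => hd (Finsupp.ext fun i => by
    fin_cases i <;> simp <;> omega)) _ _ _ _ h1 (2 * d 1)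
  rw [Finset.filter_filter] at h2
  by_contra hc
  refine hc (Eq.trans ?_ h2)
  rw [Finset.sum_eq_single_of_mem d]
  · simp [hc]; omega
  · intro e he hed
    obtain ⟨h3, h4⟩ := (Finset.mem_filter.1 he).2
    refine absurd (Finsupp.ext fun i => ?_) hed
    fin_cases i <;> simp <;> omega

theorem zetaAlgHom_injective (ha : 3 ≤ a) (hq : IsPrimitiveRoot q a)
    (h : QuasiIso (augmentation ha hq)) : Function.Injective (zetaAlgHom ha hq h) := by
  rw [injective_iff_map_eq_zero]
  intro p hp
  ext d
  -- Independence is available only away from the constant term; each coefficient of `p` is a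
  -- nonconstant coefficient of `X_0 p`, which is also in the kernel.
  rw [← MvPolynomial.coeff_X_mul d 0 p, MvPolynomial.coeff_zero]
  refine coeff_eq_zero_of_zetaAlgHom_eq_zero ha hq h _ (by rw [map_mul, hp, mul_zero]) _ ?_
  intro h0
  simpa using DFunLike.congr_fun h0 0

theorem range_zetaAlgHom (ha : 3 ≤ a) (hq : IsPrimitiveRoot q a)
    (h : QuasiIso (augmentation ha hq)) :
    Subalgebra.toSubmodule (zetaAlgHom ha hq h).range = R₀ ha hq h := by
  refine le_antisymm ?_ (Submodule.span_le.2 ?_)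
  · rintro _ ⟨p, rfl⟩
    change zetaAlgHom ha hq h p ∈ _
    rw [zetaAlgHom_apply]
    exact Submodule.sum_mem _ fun d _ => Submodule.smul_mem _ _
      (Submodule.subset_span ⟨_, _, _, even_two_mul _, rfl⟩)
  · rintro _ ⟨t, j, hj, ⟨i, rfl⟩, rfl⟩
    refine ⟨MvPolynomial.monomial (Finsupp.single 0 (t - i) + Finsupp.single 1 i) 1, ?_⟩
    change zetaAlgHom ha hq h _ = _
    rw [zetaAlgHom_monomial, one_smul]
    refine of_zetaExt_congr ha hq h (even_two_mul _) (by omega) ?_ ?_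
    · simp; omega
    · simp; omega

end

end HochschildQCI

theorem mainTheorem8 {k : Type*} [Field k] (a : ℕ) (ha : 3 ≤ a) (q : k)
    (hq : IsPrimitiveRoot q a) :
    ∃ hP : QuasiIso (HochschildQCI.augmentation ha hq),
      ∃ S : Subalgebra k (HochschildQCI.HH k (HochschildQCI.QCI k a q)),
        Subalgebra.toSubmodule S = HochschildQCI.R₀ ha hq hP ∧
          Nonempty (S ≃ₐ[k] MvPolynomial (Fin 2) k) := by
  have hP := HochschildQCI.quasiIso_augmentation ha hq
  exact ⟨hP, (HochschildQCI.zetaAlgHom ha hq hP).range, HochschildQCI.range_zetaAlgHom ha hq hP,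
    ⟨(AlgEquiv.ofInjective _ (HochschildQCI.zetaAlgHom_injective ha hq hP)).symm⟩⟩
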